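/- Let $k$ be an algebraically closed field of characteristic zero. For a monoidal preadditive category $\mathcal C$ with Drinfeld center $\mathcal Z(\mathcal C)$ and canonical braiding $\beta_{X,Y}\colon X\otimes Y\to Y\otimes X$, put $\beta^2_{X,Y}=\beta_{Y,X}\beta_{X,Y}$; the exponent $\exp\mathcal C$ is the smallest integer $N\ge 1$ such that $(\beta^2_{X,Y})^N-\mathrm{id}$ is nilpotent for all $X,Y\in\mathcal Z(\mathcal C)$. For a finite-dimensional semisimple quasi-Hopf algebra $H$ over $k$, $\exp H$ is the exponent of the tensor category $\operatorname{Rep}H$ of finite-dimensional $H$-modules. For a finite group $G$ and a normalized 3-cocycle $\omega\colon G\times G\times G\to k^\times$, let $(k^G,\omega)$ be the algebra of functions on $G$ with its usual coproduct and counit and with associator $\sum\omega(a,b,c)\,e_a\otimes e_b\otimes e_c$, and let $D^\omega G$ be the twisted quantum double: it has basis $e_g\# x$ $(g,x\in G)$, unit $\sum_g e_g\#1$, counit $\epsilon(e_g\# x)=\delta_{g,1}$, associator $\sum\omega(a,b,c)^{-1}\,(e_a\#1)\otimes (e_b\#1)\otimes (e_c\#1)$, and $$(e_g\# x)(e_h\#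 y)=\delta_{g,xhx^{-1}}\,\theta_g(x,y)\,e_g\# xy,\qquad \Delta(e_g\# x)=\sum_{st=g}\gamma_x(s,t)\,(e_s\# x)\otimes (e_t\# x),$$ $$\theta_g(x,y)=\frac{\omega(g,x,y)\,\omega(x,y,(xy)^{-1}gxy)}{\omega(x,x^{-1}gx,y)},\qquad \gamma_g(x,y)=\frac{\omega(x,y,g)\,\omega(g,g^{-1}xg,g^{-1}yg)}{\omega(x,g,g^{-1}yg)}.$$ Lemma. Let $n\ge 1$ be odd, let $C_n=\langle a : a^n=1\rangle$ be cyclic of order $n$, let $\zeta\in k^\times$ with $\zeta^n=1$, and let $\omega=\omega_\zeta$ be the 3-cocycle on $C_n$ given, for $0\le i,j,l\le n-1$, by $\omega(a^i,a^j,a^l)=\zeta^{l q_{ij}}$, where $q_{ij}=0$ if $i+j\le n-1$ and $q_{ij}=1$ if $i+j\ge n$. Then $$\exp D^{\omega}C_n=|\zeta|\,n,$$ where $|\zeta|$ is the multiplicative order of $\zeta$. In particular, if $\zeta\ne 1$ then $\exp(k^{C_n},\omega_\zeta)$ is finite and does not divide $n=|C_n|$; hence there are a finite group $G$ and a normalized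 3-cocycle $\omega$ on $G$ such that $\exp(k^G,\omega)$ (is finite and) does not divide $|G|$. -/

import Mathlib

universe u w v

namespace QuasiHopf

noncomputable section

set_option linter.unusedSectionVars false
set_option linter.unusedSimpArgs false

open CategoryTheory MonoidalCategory TensorProduct


/-- A quasi-bialgebra: `Δ` is coassociative up to conjugation by the associator `φ`,
`(id ⊗ Δ)Δ(h) φ = φ (Δ ⊗ id)Δ(h)`, and `φ` satisfies the pentagon and the triangle axioms,
`(1 ⊗ φ) (id ⊗ Δ ⊗ id)(φ) (φ ⊗ 1) = (id ⊗ id ⊗ Δ)(φ) (Δ ⊗ id ⊗ id)(φ)` and `(id ⊗ ε ⊗ id)(φ) = 1`.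
A quasi-antipode is not part of the data, since the tensor category of representations does not
depend on it. -/
structure QuasiBialgebra (k : Type u) (H : Type w) [Field k] [Ring H] [Algebra k H] where
  Δ : H →ₐ[k] H ⊗[k] H
  ε : H →ₐ[k] k
  φ : (H ⊗[k] (H ⊗[k] H))ˣ
  coassoc : ∀ h : H,
    Algebra.TensorProduct.map (AlgHom.id k H) Δ (Δ h) * φ.1 =
      φ.1 * Algebra.TensorProduct.assoc k k k H H H
        (Algebra.TensorProduct.map Δ (AlgHom.id k H) (Δ h))
  counit_left : ∀ h : H,
    Algebra.TensorProduct.lid k H (Algebra.TensorProduct.map ε (AlgHom.id k H) (Δ h)) = h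
  counit_right : ∀ h : H,
    Algebra.TensorProduct.rid k k H (Algebra.TensorProduct.map (AlgHom.id k H) ε (Δ h)) = h
  pentagon :
    (1 ⊗ₜ[k] φ.1) *
      Algebra.TensorProduct.map (AlgHom.id k H)
        ((Algebra.TensorProduct.assoc k k k H H H).toAlgHom.comp
          (Algebra.TensorProduct.map Δ (AlgHom.id k H))) φ.1 *
      Algebra.TensorProduct.map (AlgHom.id k H) (Algebra.TensorProduct.assoc k k k H H H).toAlgHom
        (Algebra.TensorProduct.assoc k k k H (H ⊗[k] H) H (φ.1 ⊗ₜ[k] 1)) =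
    Algebra.TensorProduct.map (AlgHom.id k H) (Algebra.TensorProduct.map (AlgHom.id k H) Δ) φ.1 *
      Algebra.TensorProduct.assoc k k k H H (H ⊗[k] H)
        (Algebra.TensorProduct.map Δ (AlgHom.id k (H ⊗[k] H)) φ.1)
  triangle :
    Algebra.TensorProduct.map (AlgHom.id k H)
      ((Algebra.TensorProduct.lid k H).toAlgHom.comp
        (Algebra.TensorProduct.map ε (AlgHom.id k H))) φ.1 = 1

/-- The tensor product of two representations, as a representation of the tensor product
algebra. -/
def tensorAct {k : Type u} [Field k] {A B : Type*} [Ring A] [Algebra k A] [Ring B] [Algebra k B]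
    {V W : Type u} [AddCommGroup V] [Module k V] [AddCommGroup W] [Module k W]
    (ρ : A →ₐ[k] Module.End k V) (σ : B →ₐ[k] Module.End k W) :
    A ⊗[k] B →ₐ[k] Module.End k (V ⊗[k] W) :=
  Module.endTensorEndAlgHom.comp (Algebra.TensorProduct.map ρ σ)

section
variable {k : Type u} [Field k] {A B C D : Type*} [Ring A] [Algebra k A] [Ring B] [Algebra k B]
  [Ring C] [Algebra k C] [Ring D] [Algebra k D]
  {V W X Y : Type u} [AddCommGroup V] [Module k V] [AddCommGroup W] [Module k W]
  [AddCommGroup X] [Module k X] [AddCommGroup Y] [Module k Y]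

theorem slide {M₁ M₂ M₃ M₄ : Type*} [AddCommMonoid M₁] [AddCommMonoid M₂] [AddCommMonoid M₃]
    [AddCommMonoid M₄] [Module k M₁] [Module k M₂] [Module k M₃] [Module k M₄]
    {p : M₃ →ₗ[k] M₄} {q : M₂ →ₗ[k] M₃} {r : M₁ →ₗ[k] M₂} (f : M₄ →ₗ[k] M₄)
    {t₂ t₃' : M₃ →ₗ[k] M₃} {t₃ : M₂ →ₗ[k] M₂} {s₂ s₃ : M₄ →ₗ[k] M₄}
    (h₂ : p ∘ₗ t₂ = s₂ ∘ₗ p) (h₃ : q ∘ₗ t₃ = t₃' ∘ₗ q) (h₃' : p ∘ₗ t₃' = s₃ ∘ₗ p) :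
    (f ∘ₗ p) ∘ₗ (t₂ ∘ₗ q) ∘ₗ (t₃ ∘ₗ r) = ((f ∘ₗ s₂) ∘ₗ s₃) ∘ₗ (p ∘ₗ q ∘ₗ r) := by
  ext x
  have e₂ := fun y => LinearMap.congr_fun h₂ y
  have e₃ := fun y => LinearMap.congr_fun h₃ y
  have e₃' := fun y => LinearMap.congr_fun h₃' y
  simp only [LinearMap.comp_apply] at e₂ e₃ e₃' ⊢
  rw [e₂, e₃, e₃']

theorem tensorAct_tmul (ρ : A →ₐ[k] Module.End k V) (σ : B →ₐ[k] Module.End k W)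
    (a : A) (b : B) : tensorAct ρ σ (a ⊗ₜ b) = TensorProduct.map (ρ a) (σ b) := by
  simp [tensorAct]; rfl

theorem tensorAct_assoc (ρ : A →ₐ[k] Module.End k V) (σ : B →ₐ[k] Module.End k W)
    (τ : C →ₐ[k] Module.End k X) (t : (A ⊗[k] B) ⊗[k] C) :
    (TensorProduct.assoc k V W X).toLinearMap ∘ₗ tensorAct (tensorAct ρ σ) τ t =
      tensorAct ρ (tensorAct σ τ) (Algebra.TensorProduct.assoc k k k A B C t) ∘ₗ
        (TensorProduct.assoc k V W X).toLinearMap := by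
  induction t with
  | zero => simp
  | add x y hx hy => simp only [map_add, LinearMap.comp_add, LinearMap.add_comp, hx, hy]
  | tmul ab c =>
    induction ab with
    | zero => simp
    | add x y hx hy =>
      simp only [TensorProduct.add_tmul, map_add, LinearMap.comp_add, LinearMap.add_comp, hx, hy]
    | tmul a b =>
      rw [Algebra.TensorProduct.assoc_tmul]
      simp only [tensorAct_tmul]
      apply TensorProduct.ext_threefold
      intro x y z
      simp

theorem tensorAct_comp (ρ : A →ₐ[k] Module.End k V) (σ : B →ₐ[k] Module.End k W)
    (f : C →ₐ[k] A) (g : D →ₐ[k] B) :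
    tensorAct (ρ.comp f) (σ.comp g) = (tensorAct ρ σ).comp (Algebra.TensorProduct.map f g) := by
  ext <;> simp [tensorAct]

theorem tensorAct_comp_left (ρ : A →ₐ[k] Module.End k V) (σ : B →ₐ[k] Module.End k W)
    (f : C →ₐ[k] A) (t : C ⊗[k] B) :
    tensorAct (ρ.comp f) σ t =
      tensorAct ρ σ (Algebra.TensorProduct.map f (AlgHom.id k B) t) := by
  have := tensorAct_comp ρ σ f (AlgHom.id k B)
  rw [AlgHom.comp_id] at this
  rw [this]; rfl

theorem tensorAct_comp_right (ρ : A →ₐ[k] Module.End k V) (σ : B →ₐ[k] Module.End k W)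
    (g : D →ₐ[k] B) (t : A ⊗[k] D) :
    tensorAct ρ (σ.comp g) t =
      tensorAct ρ σ (Algebra.TensorProduct.map (AlgHom.id k A) g t) := by
  have := tensorAct_comp ρ σ (AlgHom.id k A) g
  rw [AlgHom.comp_id] at this
  rw [this]; rfl

theorem tensorAct_lid (σ : B →ₐ[k] Module.End k W) (t : k ⊗[k] B) :
    (TensorProduct.lid k W).toLinearMap ∘ₗ tensorAct (Algebra.lmul k k) σ t =
      σ (Algebra.TensorProduct.lid k B t) ∘ₗ (TensorProduct.lid k W).toLinearMap := by
  induction t with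
  | zero => simp
  | add x y hx hy => simp only [map_add, LinearMap.comp_add, LinearMap.add_comp, hx, hy]
  | tmul a b =>
    rw [tensorAct_tmul]
    ext x
    simp

theorem tensorAct_rid (σ : B →ₐ[k] Module.End k W) (t : B ⊗[k] k) :
    (TensorProduct.rid k W).toLinearMap ∘ₗ tensorAct σ (Algebra.lmul k k) t =
      σ (Algebra.TensorProduct.rid k k B t) ∘ₗ (TensorProduct.rid k W).toLinearMap := by
  induction t with
  | zero => simp
  | add x y hx hy => simp only [map_add, LinearMap.comp_add, LinearMap.add_comp, hx, hy]
  | tmul a b =>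
    rw [tensorAct_tmul]
    ext x
    simp

theorem tensorAct_map {V' W' : Type u} [AddCommGroup V'] [Module k V'] [AddCommGroup W'] [Module k W']
    (ρ : A →ₐ[k] Module.End k V) (σ : B →ₐ[k] Module.End k W)
    (ρ' : A →ₐ[k] Module.End k V') (σ' : B →ₐ[k] Module.End k W')
    (f : V →ₗ[k] V') (g : W →ₗ[k] W') (hf : ∀ a, f ∘ₗ ρ a = ρ' a ∘ₗ f)
    (hg : ∀ a, g ∘ₗ σ a = σ' a ∘ₗ g) (t : A ⊗[k] B) :
    TensorProduct.map f g ∘ₗ tensorAct ρ σ t = tensorAct ρ' σ' t ∘ₗ TensorProduct.map f g := by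
  induction t with
  | zero => simp
  | add x y hx hy => simp only [map_add, LinearMap.comp_add, LinearMap.add_comp, hx, hy]
  | tmul a b => simp only [tensorAct_tmul, ← TensorProduct.map_comp, hf, hg]

end

variable {k : Type u} {H : Type w} [Field k] [Ring H] [Algebra k H]

/-- Finite-dimensional representations of the algebra underlying a quasi-bialgebra. -/
structure FinRep (B : QuasiBialgebra k H) where
  V : Type u
  [grp : AddCommGroup V]
  [mod : Module k V]
  [fin : FiniteDimensional k V]
  ρ : H →ₐ[k] Module.End k V

namespace FinRep

variable {B : QuasiBialgebra k H}

attribute [instance] FinRep.grp FinRep.mod FinRep.fin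

/-- Intertwining linear maps. -/
@[ext]
structure Hom (M N : FinRep B) where
  lin : M.V →ₗ[k] N.V
  comm : ∀ h : H, lin ∘ₗ M.ρ h = N.ρ h ∘ₗ lin

instance : Category (FinRep B) where
  Hom M N := Hom M N
  id M := ⟨LinearMap.id, fun _ => rfl⟩
  comp f g := ⟨g.lin ∘ₗ f.lin, fun h => by
    rw [LinearMap.comp_assoc, f.comm, ← LinearMap.comp_assoc, g.comm, LinearMap.comp_assoc]⟩

@[ext] theorem hom_ext {M N : FinRep B} {f g : M ⟶ N} (h : f.lin = g.lin) : f = g := Hom.ext h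

@[simp] theorem id_lin (M : FinRep B) : Hom.lin (𝟙 M) = LinearMap.id := rfl
@[simp] theorem comp_lin {M N P : FinRep B} (f : M ⟶ N) (g : N ⟶ P) :
    (f ≫ g).lin = g.lin ∘ₗ f.lin := rfl

instance (M N : FinRep B) : Zero (M ⟶ N) := ⟨⟨0, fun h => by simp⟩⟩
instance (M N : FinRep B) : Add (M ⟶ N) :=
  ⟨fun f g => ⟨f.lin + g.lin, fun h => by
    rw [LinearMap.add_comp, f.comm, g.comm, LinearMap.comp_add]⟩⟩
instance (M N : FinRep B) : Neg (M ⟶ N) :=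
  ⟨fun f => ⟨-f.lin, fun h => by rw [LinearMap.neg_comp, f.comm, LinearMap.comp_neg]⟩⟩

@[simp] theorem zero_lin (M N : FinRep B) : (0 : M ⟶ N).lin = 0 := rfl
@[simp] theorem add_lin {M N : FinRep B} (f g : M ⟶ N) : (f + g).lin = f.lin + g.lin := rfl
@[simp] theorem neg_lin {M N : FinRep B} (f : M ⟶ N) : (-f).lin = -f.lin := rfl

instance : Preadditive (FinRep B) where
  homGroup M N :=
    { add_assoc := fun f g h => by ext1; simp [add_assoc]
      zero_add := fun f => by ext1; simp
      add_zero := fun f => by ext1; simp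
      add_comm := fun f g => by ext1; simp [add_comm]
      neg_add_cancel := fun f => by ext1; simp
      nsmul := nsmulRec
      zsmul := zsmulRec }
  add_comp _ _ _ f g h := by ext1; simp [LinearMap.comp_add]
  comp_add _ _ _ f g h := by ext1; simp [LinearMap.add_comp]

/-- An intertwining linear equivalence is an isomorphism of representations. -/
def mkIso {M N : FinRep B} (e : M.V ≃ₗ[k] N.V)
    (he : ∀ h : H, e.toLinearMap ∘ₗ M.ρ h = N.ρ h ∘ₗ e.toLinearMap) : M ≅ N where
  hom := ⟨e.toLinearMap, he⟩
  inv := ⟨e.symm.toLinearMap, fun h => by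
    ext x
    apply e.injective
    have := congrArg (fun f => f (e.symm x)) (he h)
    simp at this
    simp [this]⟩
  hom_inv_id := by ext1; simp
  inv_hom_id := by ext1; simp

@[simp] theorem mkIso_hom_lin {M N : FinRep B} (e : M.V ≃ₗ[k] N.V)
    (he : ∀ h : H, e.toLinearMap ∘ₗ M.ρ h = N.ρ h ∘ₗ e.toLinearMap) :
    (mkIso e he).hom.lin = e.toLinearMap := rfl

@[simp] theorem mkIso_inv_lin {M N : FinRep B} (e : M.V ≃ₗ[k] N.V)
    (he : ∀ h : H, e.toLinearMap ∘ₗ M.ρ h = N.ρ h ∘ₗ e.toLinearMap) :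
    (mkIso e he).inv.lin = e.symm.toLinearMap := rfl

/-- `M ⊗ N`, with `H` acting through `Δ`. -/
abbrev tensor (M N : FinRep B) : FinRep B where
  V := M.V ⊗[k] N.V
  ρ := (tensorAct M.ρ N.ρ).comp B.Δ

/-- The trivial representation, `H` acting through `ε`. -/
abbrev unit (B : QuasiBialgebra k H) : FinRep B where
  V := k
  ρ := (Algebra.lmul k k).comp B.ε

/-- The tensor product of two morphisms. -/
def map {M M' N N' : FinRep B} (f : M ⟶ M') (g : N ⟶ N') : tensor M N ⟶ tensor M' N' where
  lin := TensorProduct.map f.lin g.lin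
  comm _ := tensorAct_map _ _ _ _ _ _ f.comm g.comm _

/-- The action of the associator, as a linear automorphism of `M ⊗ (N ⊗ P)`. -/
def actφ (M N P : FinRep B) : (M.V ⊗[k] (N.V ⊗[k] P.V)) ≃ₗ[k] (M.V ⊗[k] (N.V ⊗[k] P.V)) :=
  LinearEquiv.ofLinearMap (tensorAct M.ρ (tensorAct N.ρ P.ρ) B.φ.1)
    (tensorAct M.ρ (tensorAct N.ρ P.ρ) B.φ⁻¹.1)
    (by rw [← Module.End.mul_eq_comp, ← map_mul, Units.mul_inv, map_one]; rfl)
    (by rw [← Module.End.mul_eq_comp, ← map_mul, Units.inv_mul, map_one]; rfl)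

@[simp] theorem actφ_toLinearMap (M N P : FinRep B) :
    (actφ M N P).toLinearMap = tensorAct M.ρ (tensorAct N.ρ P.ρ) B.φ.1 := rfl

/-- The associativity isomorphism: the usual one followed by the action of `φ`. -/
def assoc (M N P : FinRep B) : tensor (tensor M N) P ≅ tensor M (tensor N P) :=
  mkIso ((TensorProduct.assoc k M.V N.V P.V).trans (actφ M N P)) (by
    intro h
    change (actφ M N P).toLinearMap ∘ₗ (TensorProduct.assoc k M.V N.V P.V).toLinearMap ∘ₗ
      tensorAct ((tensorAct M.ρ N.ρ).comp B.Δ) P.ρ (B.Δ h) =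
      tensorAct M.ρ ((tensorAct N.ρ P.ρ).comp B.Δ) (B.Δ h) ∘ₗ (actφ M N P).toLinearMap ∘ₗ
        (TensorProduct.assoc k M.V N.V P.V).toLinearMap
    rw [tensorAct_comp_left, tensorAct_comp_right, tensorAct_assoc, actφ_toLinearMap,
      ← LinearMap.comp_assoc, ← LinearMap.comp_assoc, ← Module.End.mul_eq_comp,
      ← Module.End.mul_eq_comp, ← map_mul, ← map_mul, B.coassoc])

/-- The left unit isomorphism. -/
def leftUnit (M : FinRep B) : tensor (unit B) M ≅ M :=
  mkIso (TensorProduct.lid k M.V) (by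
    intro h
    change (TensorProduct.lid k M.V).toLinearMap ∘ₗ
      tensorAct ((Algebra.lmul k k).comp B.ε) M.ρ (B.Δ h) =
        M.ρ h ∘ₗ (TensorProduct.lid k M.V).toLinearMap
    rw [tensorAct_comp_left, tensorAct_lid, B.counit_left])

/-- The right unit isomorphism. -/
def rightUnit (M : FinRep B) : tensor M (unit B) ≅ M :=
  mkIso (TensorProduct.rid k M.V) (by
    intro h
    change (TensorProduct.rid k M.V).toLinearMap ∘ₗ
      tensorAct M.ρ ((Algebra.lmul k k).comp B.ε) (B.Δ h) =
        M.ρ h ∘ₗ (TensorProduct.rid k M.V).toLinearMap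
    rw [tensorAct_comp_right, tensorAct_rid, B.counit_right])

theorem assoc_lin (M N P : FinRep B) : (assoc M N P).hom.lin =
    tensorAct M.ρ (tensorAct N.ρ P.ρ) B.φ.1 ∘ₗ (TensorProduct.assoc k M.V N.V P.V).toLinearMap :=
  rfl

theorem pentagon_lin (W X Y Z : FinRep B) :
    TensorProduct.map LinearMap.id (assoc X Y Z).hom.lin ∘ₗ (assoc W (tensor X Y) Z).hom.lin ∘ₗ
      TensorProduct.map (assoc W X Y).hom.lin LinearMap.id =
    (assoc W X (tensor Y Z)).hom.lin ∘ₗ (assoc (tensor W X) Y Z).hom.lin := by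
  simp only [assoc_lin]
  change TensorProduct.map LinearMap.id (tensorAct X.ρ (tensorAct Y.ρ Z.ρ) B.φ.1 ∘ₗ
        (TensorProduct.assoc k X.V Y.V Z.V).toLinearMap) ∘ₗ
      (tensorAct W.ρ (tensorAct ((tensorAct X.ρ Y.ρ).comp B.Δ) Z.ρ) B.φ.1 ∘ₗ
        (TensorProduct.assoc k W.V (X.V ⊗[k] Y.V) Z.V).toLinearMap) ∘ₗ
      TensorProduct.map (tensorAct W.ρ (tensorAct X.ρ Y.ρ) B.φ.1 ∘ₗ
        (TensorProduct.assoc k W.V X.V Y.V).toLinearMap) LinearMap.id =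
    (tensorAct W.ρ (tensorAct X.ρ ((tensorAct Y.ρ Z.ρ).comp B.Δ)) B.φ.1 ∘ₗ
      (TensorProduct.assoc k W.V X.V (Y.V ⊗[k] Z.V)).toLinearMap) ∘ₗ
    (tensorAct ((tensorAct W.ρ X.ρ).comp B.Δ) (tensorAct Y.ρ Z.ρ) B.φ.1 ∘ₗ
      (TensorProduct.assoc k (W.V ⊗[k] X.V) Y.V Z.V).toLinearMap)
  set A4 := tensorAct W.ρ (tensorAct X.ρ (tensorAct Y.ρ Z.ρ)) with hA4
  have h1 : TensorProduct.map LinearMap.id (tensorAct X.ρ (tensorAct Y.ρ Z.ρ) B.φ.1) =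
      A4 (1 ⊗ₜ B.φ.1) := by
    rw [hA4, tensorAct_tmul, map_one]; rfl
  have h2 : tensorAct W.ρ (tensorAct ((tensorAct X.ρ Y.ρ).comp B.Δ) Z.ρ) B.φ.1 =
      tensorAct W.ρ (tensorAct (tensorAct X.ρ Y.ρ) Z.ρ)
        (Algebra.TensorProduct.map (AlgHom.id k H)
          (Algebra.TensorProduct.map B.Δ (AlgHom.id k H)) B.φ.1) := by
    rw [← tensorAct_comp_right]
    congr 2
    exact AlgHom.ext fun t => tensorAct_comp_left _ _ _ _
  have h3 : ∀ t, TensorProduct.map LinearMap.id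
        (TensorProduct.assoc k X.V Y.V Z.V).toLinearMap ∘ₗ
        tensorAct W.ρ (tensorAct (tensorAct X.ρ Y.ρ) Z.ρ) t =
      A4 (Algebra.TensorProduct.map (AlgHom.id k H)
        (Algebra.TensorProduct.assoc k k k H H H).toAlgHom t) ∘ₗ
      TensorProduct.map LinearMap.id (TensorProduct.assoc k X.V Y.V Z.V).toLinearMap := by
    intro t
    rw [hA4, ← tensorAct_comp_right]
    apply tensorAct_map
    · intro a; rfl
    · intro a; exact tensorAct_assoc _ _ _ _
  have h4 : (TensorProduct.assoc k W.V (X.V ⊗[k] Y.V) Z.V).toLinearMap ∘ₗ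
        TensorProduct.map (tensorAct W.ρ (tensorAct X.ρ Y.ρ) B.φ.1) LinearMap.id =
      tensorAct W.ρ (tensorAct (tensorAct X.ρ Y.ρ) Z.ρ)
        (Algebra.TensorProduct.assoc k k k H (H ⊗[k] H) H (B.φ.1 ⊗ₜ[k] 1)) ∘ₗ
      (TensorProduct.assoc k W.V (X.V ⊗[k] Y.V) Z.V).toLinearMap := by
    rw [← tensorAct_assoc, tensorAct_tmul, map_one]; rfl
  have h5 : tensorAct W.ρ (tensorAct X.ρ ((tensorAct Y.ρ Z.ρ).comp B.Δ)) B.φ.1 =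
      A4 (Algebra.TensorProduct.map (AlgHom.id k H)
        (Algebra.TensorProduct.map (AlgHom.id k H) B.Δ) B.φ.1) := by
    rw [hA4, ← tensorAct_comp_right]
    congr 2
    exact AlgHom.ext fun t => tensorAct_comp_right _ _ _ _
  have hcoh : TensorProduct.map LinearMap.id (TensorProduct.assoc k X.V Y.V Z.V).toLinearMap ∘ₗ
      (TensorProduct.assoc k W.V (X.V ⊗[k] Y.V) Z.V).toLinearMap ∘ₗ
      TensorProduct.map (TensorProduct.assoc k W.V X.V Y.V).toLinearMap LinearMap.id =
      (TensorProduct.assoc k W.V X.V (Y.V ⊗[k] Z.V)).toLinearMap ∘ₗ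
      (TensorProduct.assoc k (W.V ⊗[k] X.V) Y.V Z.V).toLinearMap := by
    apply TensorProduct.ext_fourfold
    intro w x y z
    rfl
  have hl : ∀ (f : X.V ⊗[k] (Y.V ⊗[k] Z.V) →ₗ[k] X.V ⊗[k] (Y.V ⊗[k] Z.V))
      (g : (X.V ⊗[k] Y.V) ⊗[k] Z.V →ₗ[k] X.V ⊗[k] (Y.V ⊗[k] Z.V)),
      TensorProduct.map (LinearMap.id : W.V →ₗ[k] W.V) (f ∘ₗ g) =
        TensorProduct.map LinearMap.id f ∘ₗ TensorProduct.map LinearMap.id g := by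
    intro f g; rw [← TensorProduct.map_comp, LinearMap.id_comp]
  have hr : ∀ (f : W.V ⊗[k] (X.V ⊗[k] Y.V) →ₗ[k] W.V ⊗[k] (X.V ⊗[k] Y.V))
      (g : (W.V ⊗[k] X.V) ⊗[k] Y.V →ₗ[k] W.V ⊗[k] (X.V ⊗[k] Y.V)),
      TensorProduct.map (f ∘ₗ g) (LinearMap.id : Z.V →ₗ[k] Z.V) =
        TensorProduct.map f LinearMap.id ∘ₗ TensorProduct.map g LinearMap.id := by
    intro f g; rw [← TensorProduct.map_comp, LinearMap.id_comp]
  have hR : ((TensorProduct.assoc k W.V X.V (Y.V ⊗[k] Z.V)).toLinearMap) ∘ₗ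
      tensorAct ((tensorAct W.ρ X.ρ).comp B.Δ) (tensorAct Y.ρ Z.ρ) B.φ.1 =
      A4 (Algebra.TensorProduct.assoc k k k H H (H ⊗[k] H)
        (Algebra.TensorProduct.map B.Δ (AlgHom.id k (H ⊗[k] H)) B.φ.1)) ∘ₗ
      (TensorProduct.assoc k W.V X.V (Y.V ⊗[k] Z.V)).toLinearMap := by
    rw [tensorAct_comp_left, tensorAct_assoc]
  have hmm : Algebra.TensorProduct.map (AlgHom.id k H)
        ((Algebra.TensorProduct.assoc k k k H H H).toAlgHom.comp
          (Algebra.TensorProduct.map B.Δ (AlgHom.id k H))) B.φ.1 =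
      Algebra.TensorProduct.map (AlgHom.id k H) (Algebra.TensorProduct.assoc k k k H H H).toAlgHom
        (Algebra.TensorProduct.map (AlgHom.id k H)
          (Algebra.TensorProduct.map B.Δ (AlgHom.id k H)) B.φ.1) := by
    rw [← AlgHom.comp_apply, ← Algebra.TensorProduct.map_comp, AlgHom.id_comp]
  have hp := congrArg A4 B.pentagon
  rw [hmm, map_mul, map_mul, map_mul] at hp
  simp only [Module.End.mul_eq_comp] at hp
  rw [hl, hr, h1, h2, h5]
  rw [slide _ (h3 _) h4 (h3 _), hp, hcoh]
  simp only [LinearMap.comp_assoc]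
  rw [← LinearMap.comp_assoc _ _ (TensorProduct.assoc k W.V X.V (Y.V ⊗[k] Z.V)).toLinearMap,
    hR, LinearMap.comp_assoc]

theorem triangle_lin (X Y : FinRep B) :
    TensorProduct.map LinearMap.id (leftUnit Y).hom.lin ∘ₗ (assoc X (unit B) Y).hom.lin =
      TensorProduct.map (rightUnit X).hom.lin LinearMap.id := by
  have h1 : ∀ t, TensorProduct.map LinearMap.id (TensorProduct.lid k Y.V).toLinearMap ∘ₗ
      tensorAct X.ρ (tensorAct ((Algebra.lmul k k).comp B.ε) Y.ρ) t =
      tensorAct X.ρ (Y.ρ.comp ((Algebra.TensorProduct.lid k H).toAlgHom.comp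
        (Algebra.TensorProduct.map B.ε (AlgHom.id k H)))) t ∘ₗ
        TensorProduct.map LinearMap.id (TensorProduct.lid k Y.V).toLinearMap := by
    intro t
    apply tensorAct_map
    · intro a; rfl
    · intro a
      rw [tensorAct_comp_left, tensorAct_lid]
      rfl
  change TensorProduct.map LinearMap.id (TensorProduct.lid k Y.V).toLinearMap ∘ₗ
    tensorAct X.ρ (tensorAct ((Algebra.lmul k k).comp B.ε) Y.ρ) B.φ.1 ∘ₗ
    (TensorProduct.assoc k X.V k Y.V).toLinearMap =
      TensorProduct.map (TensorProduct.rid k X.V).toLinearMap LinearMap.id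
  rw [← LinearMap.comp_assoc, h1, tensorAct_comp_right, B.triangle, map_one]
  apply TensorProduct.ext_threefold
  intro x a y
  simp [TensorProduct.smul_tmul]

/-- The tensor category `Rep (H, φ)`. -/
instance : MonoidalCategory (FinRep B) where
  tensorObj := tensor
  tensorUnit := unit B
  tensorHom := map
  whiskerLeft M _ _ f := map (𝟙 M) f
  whiskerRight f M := map f (𝟙 M)
  associator := assoc
  leftUnitor := leftUnit
  rightUnitor := rightUnit
  tensorHom_def f g := by
    ext1
    exact (by rw [← TensorProduct.map_comp, LinearMap.id_comp, LinearMap.comp_id] :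
      TensorProduct.map f.lin g.lin =
        TensorProduct.map LinearMap.id g.lin ∘ₗ TensorProduct.map f.lin LinearMap.id)
  id_tensorHom_id M N := by
    ext1
    exact TensorProduct.map_id
  tensorHom_comp_tensorHom f g f' g' := by
    ext1
    exact (TensorProduct.map_comp _ _ _ _).symm
  whiskerLeft_id M N := by
    ext1
    exact TensorProduct.map_id
  id_whiskerRight M N := by
    ext1
    exact TensorProduct.map_id
  associator_naturality {M N P M' N' P'} f g h := by
    ext1
    change (tensorAct M'.ρ (tensorAct N'.ρ P'.ρ) B.φ.1 ∘ₗ _) ∘ₗ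
        TensorProduct.map (TensorProduct.map f.lin g.lin) h.lin =
      TensorProduct.map f.lin (TensorProduct.map g.lin h.lin) ∘ₗ
        tensorAct M.ρ (tensorAct N.ρ P.ρ) B.φ.1 ∘ₗ _
    rw [← LinearMap.comp_assoc, tensorAct_map _ _ M'.ρ (tensorAct N'.ρ P'.ρ) _ _ f.comm
      (tensorAct_map _ _ _ _ _ _ g.comm h.comm), LinearMap.comp_assoc, LinearMap.comp_assoc]
    congr 1
    apply TensorProduct.ext_threefold
    intro x y z
    rfl
  leftUnitor_naturality {M N} f := by
    ext1
    change (TensorProduct.lid k N.V).toLinearMap ∘ₗ TensorProduct.map LinearMap.id f.lin =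
      f.lin ∘ₗ (TensorProduct.lid k M.V).toLinearMap
    ext x
    simp
  rightUnitor_naturality {M N} f := by
    ext1
    change (TensorProduct.rid k N.V).toLinearMap ∘ₗ TensorProduct.map f.lin LinearMap.id =
      f.lin ∘ₗ (TensorProduct.rid k M.V).toLinearMap
    ext x
    simp
  pentagon W X Y Z := by
    ext1
    exact pentagon_lin W X Y Z
  triangle X Y := by
    ext1
    exact triangle_lin X Y

end FinRep

/-- The double braiding `β² = β_{Y,X} β_{X,Y}` of two objects of the Drinfeld center. -/
def doubleBraiding {C : Type*} [Category C] [MonoidalCategory C] (X Y : Center C) :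
    End (X ⊗ Y) := (β_ X Y).hom ≫ (β_ Y X).hom

/-- The (quasi-)exponent of a monoidal category: the smallest integer `N ≥ 1` such that `(β²)^N` is
unipotent on every tensor product of two objects of the Drinfeld center. -/
def exponent (C : Type*) [Category C] [Preadditive C] [MonoidalCategory C] : ℕ :=
  sInf {N : ℕ | 0 < N ∧ ∀ X Y : Center C,
    IsNilpotent ((Center.forget C).mapEnd (X ⊗ Y) (doubleBraiding X Y ^ N) - 1)}

/-- The exponent of `(H, φ)` is the exponent of its category of finite-dimensional
representations. -/
def QuasiBialgebra.exponent (B : QuasiBialgebra k H) : ℕ := QuasiHopf.exponent (FinRep B)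



/-- Normalized 3-cocycles on `G` with values in `kˣ` (trivial action). -/
structure Cocycle3 (G : Type v) (k : Type u) [Group G] [Field k] where
  toFun : G → G → G → kˣ
  cocycle : ∀ a b c d : G,
    toFun b c d * toFun a (b * c) d * toFun a b c = toFun (a * b) c d * toFun a b (c * d)
  one_left : ∀ b c : G, toFun 1 b c = 1
  one_mid : ∀ a c : G, toFun a 1 c = 1
  one_right : ∀ a b : G, toFun a b 1 = 1

namespace Cocycle3

variable {G : Type v} {k : Type u} [Group G] [Field k] (ω : Cocycle3 G k)

/-- `θ_g(x, y) = ω(g, x, y) ω(x, y, (xy)⁻¹g(xy)) / ω(x, x⁻¹gx, y)`. -/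
def θ (g x y : G) : kˣ :=
  ω.toFun g x y * ω.toFun x y ((x * y)⁻¹ * g * (x * y)) / ω.toFun x (x⁻¹ * g * x) y

/-- `γ_g(x, y) = ω(x, y, g) ω(g, g⁻¹xg, g⁻¹yg) / ω(x, g, g⁻¹yg)`. -/
def γ (g x y : G) : kˣ :=
  ω.toFun x y g * ω.toFun g (g⁻¹ * x * g) (g⁻¹ * y * g) / ω.toFun x g (g⁻¹ * y * g)

theorem add_cocycle (a b c d : G) :
    Additive.ofMul (ω.toFun b c d) + Additive.ofMul (ω.toFun a (b * c) d) +
      Additive.ofMul (ω.toFun a b c) =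
    Additive.ofMul (ω.toFun (a * b) c d) + Additive.ofMul (ω.toFun a b (c * d)) :=
  congrArg Additive.ofMul (ω.cocycle a b c d)

theorem θ_mul (g x y z : G) :
    ω.θ g x y * ω.θ g (x * y) z = ω.θ g x (y * z) * ω.θ (x⁻¹ * g * x) y z := by
  apply Additive.ofMul.injective
  have h1 := ω.add_cocycle g x y z
  have h2 := ω.add_cocycle x (x⁻¹ * g * x) y z
  have h3 := ω.add_cocycle x y (y⁻¹ * x⁻¹ * g * x * y) z
  have h4 := ω.add_cocycle x y z (z⁻¹ * y⁻¹ * x⁻¹ * g * x * y * z)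
  simp only [θ, ofMul_mul, ofMul_div, mul_assoc, mul_inv_rev, mul_inv_cancel_left,
    inv_mul_cancel_left] at *
  linear_combination (norm := module) h1 - h2 + h3 - h4

theorem γ_mul (x a b c : G) :
    ω.γ x b c * ω.γ x a (b * c) * ω.toFun a b c =
      ω.γ x a b * ω.γ x (a * b) c *
        ω.toFun (x⁻¹ * a * x) (x⁻¹ * b * x) (x⁻¹ * c * x) := by
  apply Additive.ofMul.injective
  have h1 := ω.add_cocycle a b c x
  have h2 := ω.add_cocycle a b x (x⁻¹ * c * x)
  have h3 := ω.add_cocycle a x (x⁻¹ * b * x) (x⁻¹ * c * x)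
  have h4 := ω.add_cocycle x (x⁻¹ * a * x) (x⁻¹ * b * x) (x⁻¹ * c * x)
  simp only [γ, ofMul_mul, ofMul_div, mul_assoc, mul_inv_rev, mul_inv_cancel_left,
    inv_mul_cancel_left] at *
  linear_combination (norm := module) h1 - h2 + h3 - h4

theorem θ_γ (g h x y : G) :
    ω.θ (g * h) x y * ω.γ (x * y) g h =
      ω.θ g x y * ω.θ h x y * ω.γ x g h * ω.γ y (x⁻¹ * g * x) (x⁻¹ * h * x) := by
  apply Additive.ofMul.injective
  have h1 := ω.add_cocycle g h x y
  have h2 := ω.add_cocycle g x (x⁻¹ * h * x) y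
  have h3 := ω.add_cocycle x (x⁻¹ * g * x) (x⁻¹ * h * x) y
  have h4 := ω.add_cocycle g x y (y⁻¹ * x⁻¹ * h * x * y)
  have h5 := ω.add_cocycle x (x⁻¹ * g * x) y (y⁻¹ * x⁻¹ * h * x * y)
  have h6 := ω.add_cocycle x y (y⁻¹ * x⁻¹ * g * x * y) (y⁻¹ * x⁻¹ * h * x * y)
  simp only [θ, γ, ofMul_mul, ofMul_div, mul_assoc, mul_inv_rev, mul_inv_cancel_left,
    inv_mul_cancel_left] at *
  linear_combination (norm := module) -h1 + h2 - h3 - h4 + h5 - h6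

@[simp] theorem θ_one_left (g x : G) : ω.θ g 1 x = 1 := by
  simp [θ, one_left, one_mid]

@[simp] theorem θ_one_right (g x : G) : ω.θ g x 1 = 1 := by
  simp [θ, one_mid, one_right]

@[simp] theorem θ_one (x y : G) : ω.θ 1 x y = 1 := by
  simp [θ, one_left, one_mid, one_right]

@[simp] theorem γ_one (x y : G) : ω.γ 1 x y = 1 := by
  simp [γ, one_left, one_mid, one_right]

@[simp] theorem γ_one_left (g x : G) : ω.γ g 1 x = 1 := by
  simp [γ, one_left, one_mid]

@[simp] theorem γ_one_right (g x : G) : ω.γ g x 1 = 1 := by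
  simp [γ, one_mid, one_right]

end Cocycle3

section Diagonal

theorem sum_convolution {G : Type v} [Group G] [Fintype G] {M : Type*} [AddCommMonoid M]
    (f : G → G → G → M) : ∑ b, ∑ s, f b s (s⁻¹ * b) = ∑ s, ∑ t, f (s * t) s t := by
  rw [Finset.sum_comm]
  refine Finset.sum_congr rfl fun s _ => ?_
  refine Fintype.sum_equiv (Equiv.mulLeft s⁻¹) _ _ fun b => ?_
  simp

variable {G : Type v} {k : Type u} {H : Type w} [Fintype G]
  [Field k] [Ring H] [Algebra k H]

/-- The element `∑ F(a, b, c) e_a ⊗ e_b ⊗ e_c`. -/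
def diag₃ (e : G → H) (F : G → G → G → k) : H ⊗[k] (H ⊗[k] H) :=
  ∑ p : G × G × G, F p.1 p.2.1 p.2.2 • (e p.1 ⊗ₜ[k] (e p.2.1 ⊗ₜ[k] e p.2.2))

/-- The element `∑ F(a, b, c, d) e_a ⊗ e_b ⊗ e_c ⊗ e_d`. -/
def diag₄ (e : G → H) (F : G → G → G → G → k) : H ⊗[k] (H ⊗[k] (H ⊗[k] H)) :=
  ∑ p : G × G × G × G, F p.1 p.2.1 p.2.2.1 p.2.2.2 •
    (e p.1 ⊗ₜ[k] (e p.2.1 ⊗ₜ[k] (e p.2.2.1 ⊗ₜ[k] e p.2.2.2)))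

variable {e : G → H}

theorem sum_smul_mul {ι A : Type*} [Fintype ι] [DecidableEq ι] [Ring A] [Algebra k A] {E : ι → A}
    (hE : ∀ a b, E a * E b = if a = b then E a else 0) (F F' : ι → k) :
    (∑ p, F p • E p) * (∑ p, F' p • E p) = ∑ p, (F p * F' p) • E p := by
  simp only [Finset.sum_mul_sum, smul_mul_smul_comm, hE, smul_ite, smul_zero, Finset.sum_ite_eq,
    Finset.mem_univ, if_true]

theorem sum_smul_mul_single {ι A : Type*} [Fintype ι] [DecidableEq ι] [Ring A] [Algebra k A]
    {E : ι → A} {y : A} (q : ι) (hE : ∀ p, E p * y = if p = q then y else 0) (F : ι → k) :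
    (∑ p, F p • E p) * y = F q • y := by
  simp only [Finset.sum_mul, smul_mul_assoc, hE, smul_ite, smul_zero, Finset.sum_ite_eq',
    Finset.mem_univ, if_true]

theorem mul_sum_smul_single {ι A : Type*} [Fintype ι] [DecidableEq ι] [Ring A] [Algebra k A]
    {E : ι → A} {y : A} (q : ι) (hE : ∀ p, y * E p = if p = q then y else 0) (F : ι → k) :
    y * (∑ p, F p • E p) = F q • y := by
  simp only [Finset.mul_sum, mul_smul_comm, hE, smul_ite, smul_zero, Finset.sum_ite_eq',
    Finset.mem_univ, if_true]

theorem tmul_orthogonal {ι κ A B : Type*} [DecidableEq ι] [DecidableEq κ] [Ring A] [Algebra k A]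
    [Ring B] [Algebra k B] {E : ι → A} {E' : κ → B}
    (hE : ∀ a b, E a * E b = if a = b then E a else 0)
    (hE' : ∀ a b, E' a * E' b = if a = b then E' a else 0) (a b : ι × κ) :
    (E a.1 ⊗ₜ[k] E' a.2) * (E b.1 ⊗ₜ[k] E' b.2) = if a = b then E a.1 ⊗ₜ[k] E' a.2 else 0 := by
  obtain ⟨a, a'⟩ := a
  obtain ⟨b, b'⟩ := b
  by_cases h1 : a = b <;> by_cases h2 : a' = b' <;> simp [hE, hE', h1, h2]

theorem diag₃_mul [DecidableEq G] (he : ∀ a b, e a * e b = if a = b then e a else 0)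
    (F F' : G → G → G → k) :
    diag₃ e F * diag₃ e F' = diag₃ e (fun a b c => F a b c * F' a b c) :=
  sum_smul_mul (E := fun p : G × G × G => e p.1 ⊗ₜ[k] (e p.2.1 ⊗ₜ[k] e p.2.2))
    (tmul_orthogonal he (tmul_orthogonal he he)) _ _

theorem diag₄_mul [DecidableEq G] (he : ∀ a b, e a * e b = if a = b then e a else 0)
    (F F' : G → G → G → G → k) :
    diag₄ e F * diag₄ e F' = diag₄ e (fun a b c d => F a b c d * F' a b c d) := by
  have h := sum_smul_mul (E := fun p : G × G × G × G =>
      e p.1 ⊗ₜ[k] (e p.2.1 ⊗ₜ[k] (e p.2.2.1 ⊗ₜ[k] e p.2.2.2)))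
    (tmul_orthogonal he (tmul_orthogonal he (tmul_orthogonal he he)))
    (fun p => F p.1 p.2.1 p.2.2.1 p.2.2.2) (fun p => F' p.1 p.2.1 p.2.2.1 p.2.2.2)
  exact h

theorem diag₃_one (hs : ∑ a, e a = 1) : diag₃ e (fun _ _ _ => (1 : k)) = 1 := by
  simp only [diag₃, one_smul, Fintype.sum_prod_type, ← TensorProduct.tmul_sum,
    ← TensorProduct.sum_tmul, hs]
  rfl

/-- The invertible element `∑ F(a, b, c) e_a ⊗ e_b ⊗ e_c`. -/
def diagUnit [DecidableEq G] (he : ∀ a b, e a * e b = if a = b then e a else 0)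
    (hs : ∑ a, e a = 1) (F : G → G → G → kˣ) : (H ⊗[k] (H ⊗[k] H))ˣ where
  val := diag₃ e (fun a b c => (F a b c : k))
  inv := diag₃ e (fun a b c => ((F a b c)⁻¹ : kˣ))
  val_inv := by rw [diag₃_mul he]; simpa using diag₃_one hs
  inv_val := by rw [diag₃_mul he]; simpa using diag₃_one hs

variable [Group G]

theorem diag_pentagon [DecidableEq G] (he : ∀ a b, e a * e b = if a = b then e a else 0)
    (hs : ∑ a, e a = 1) (Δ : H →ₐ[k] H ⊗[k] H)
    (hΔ : ∀ g, Δ (e g) = ∑ s, e s ⊗ₜ[k] e (s⁻¹ * g)) (F : G → G → G → k)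
    (hF : ∀ a b c d, F b c d * F a (b * c) d * F a b c = F a b (c * d) * F (a * b) c d) :
    (1 ⊗ₜ[k] diag₃ e F) *
      Algebra.TensorProduct.map (AlgHom.id k H)
        ((Algebra.TensorProduct.assoc k k k H H H).toAlgHom.comp
          (Algebra.TensorProduct.map Δ (AlgHom.id k H))) (diag₃ e F) *
      Algebra.TensorProduct.map (AlgHom.id k H) (Algebra.TensorProduct.assoc k k k H H H).toAlgHom
        (Algebra.TensorProduct.assoc k k k H (H ⊗[k] H) H (diag₃ e F ⊗ₜ[k] 1)) =
    Algebra.TensorProduct.map (AlgHom.id k H) (Algebra.TensorProduct.map (AlgHom.id k H) Δ)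
        (diag₃ e F) *
      Algebra.TensorProduct.assoc k k k H H (H ⊗[k] H)
        (Algebra.TensorProduct.map Δ (AlgHom.id k (H ⊗[k] H)) (diag₃ e F)) := by
  have h1 : (1 ⊗ₜ[k] diag₃ e F : H ⊗[k] (H ⊗[k] (H ⊗[k] H))) =
      diag₄ e (fun _ b c d => F b c d) := by
    rw [← hs, TensorProduct.sum_tmul]
    simp only [diag₃, diag₄, Fintype.sum_prod_type, TensorProduct.tmul_sum,
      TensorProduct.tmul_smul]
  have h2 : Algebra.TensorProduct.map (AlgHom.id k H)
        ((Algebra.TensorProduct.assoc k k k H H H).toAlgHom.comp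
          (Algebra.TensorProduct.map Δ (AlgHom.id k H))) (diag₃ e F) =
      diag₄ e (fun a b c d => F a (b * c) d) := by
    simp only [diag₃, diag₄, Fintype.sum_prod_type, map_sum, map_smul,
      Algebra.TensorProduct.map_tmul, AlgHom.coe_id, id_eq, AlgHom.comp_apply, hΔ,
      TensorProduct.sum_tmul, TensorProduct.tmul_sum, Finset.smul_sum]
    refine Finset.sum_congr rfl fun a _ => ?_
    exact (Finset.sum_congr rfl fun b _ => Finset.sum_comm).trans
      (sum_convolution (fun b s t => ∑ c, F a b c • (e a ⊗ₜ[k] (e s ⊗ₜ[k] (e t ⊗ₜ[k] e c)))))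
  have h3 : Algebra.TensorProduct.map (AlgHom.id k H)
        (Algebra.TensorProduct.assoc k k k H H H).toAlgHom
        (Algebra.TensorProduct.assoc k k k H (H ⊗[k] H) H (diag₃ e F ⊗ₜ[k] 1)) =
      diag₄ e (fun a b c _ => F a b c) := by
    simp only [diag₃, diag₄, Fintype.sum_prod_type, ← Finset.smul_sum, ← TensorProduct.tmul_sum, hs,
      TensorProduct.sum_tmul, map_sum, TensorProduct.smul_tmul', map_smul]
    rfl
  have h4 : Algebra.TensorProduct.map (AlgHom.id k H)
        (Algebra.TensorProduct.map (AlgHom.id k H) Δ) (diag₃ e F) =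
      diag₄ e (fun a b c d => F a b (c * d)) := by
    simp only [diag₃, diag₄, Fintype.sum_prod_type, map_sum, map_smul,
      Algebra.TensorProduct.map_tmul, AlgHom.coe_id, id_eq, AlgHom.comp_apply, hΔ,
      TensorProduct.sum_tmul, TensorProduct.tmul_sum, Finset.smul_sum]
    refine Finset.sum_congr rfl fun a _ => Finset.sum_congr rfl fun b _ => ?_
    exact sum_convolution (fun c s t => F a b c • (e a ⊗ₜ[k] (e b ⊗ₜ[k] (e s ⊗ₜ[k] e t))))
  have h5 : Algebra.TensorProduct.assoc k k k H H (H ⊗[k] H)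
        (Algebra.TensorProduct.map Δ (AlgHom.id k (H ⊗[k] H)) (diag₃ e F)) =
      diag₄ e (fun a b c d => F (a * b) c d) := by
    simp only [diag₃, diag₄, Fintype.sum_prod_type, map_sum, map_smul,
      Algebra.TensorProduct.map_tmul, AlgHom.coe_id, id_eq, AlgHom.comp_apply, hΔ,
      TensorProduct.sum_tmul, TensorProduct.tmul_sum, Finset.smul_sum]
    exact (Finset.sum_congr rfl fun a _ =>
      (Finset.sum_congr rfl fun b _ => Finset.sum_comm).trans Finset.sum_comm).trans
      (sum_convolution (fun a s t => ∑ b, ∑ c, F a b c • (e s ⊗ₜ[k] (e t ⊗ₜ[k] (e b ⊗ₜ[k] e c)))))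
  rw [h1, h2, h3, h4, h5, diag₄_mul he, diag₄_mul he, diag₄_mul he]
  congr 1
  funext a b c d
  exact hF a b c d

theorem diag_triangle (hs : ∑ a, e a = 1) [DecidableEq G] (ε : H →ₐ[k] k)
    (hε : ∀ g, ε (e g) = if g = 1 then 1 else 0) (F : G → G → G → k) (hF : ∀ a c, F a 1 c = 1) :
    Algebra.TensorProduct.map (AlgHom.id k H)
      ((Algebra.TensorProduct.lid k H).toAlgHom.comp
        (Algebra.TensorProduct.map ε (AlgHom.id k H))) (diag₃ e F) = 1 := by
  simp only [diag₃, Fintype.sum_prod_type, map_sum, map_smul,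
    Algebra.TensorProduct.map_tmul, AlgHom.coe_id, id_eq, AlgHom.comp_apply, hε]
  have h : ∀ a b c, F a b c • (e a ⊗ₜ[k] ((Algebra.TensorProduct.lid k H).toAlgHom
      ((if b = 1 then (1 : k) else 0) ⊗ₜ[k] e c))) = if b = 1 then e a ⊗ₜ[k] e c else 0 := by
    intro a b c
    split_ifs with hb
    · subst hb; simp [hF]
    · simp
  simp only [h, Finset.sum_ite_irrel, Finset.sum_const_zero, Finset.sum_ite_eq', Finset.mem_univ,
    if_true, ← TensorProduct.tmul_sum, ← TensorProduct.sum_tmul, hs]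
  rfl

end Diagonal


section FunctionAlgebra

/-- The algebra `k^G` of `k`-valued functions on `G`, with pointwise operations. -/
def FunAlg (G : Type v) (k : Type u) : Type (max u v) := G → k

namespace FunAlg

variable {G : Type v} {k : Type u} [Field k]

instance : Ring (FunAlg G k) := inferInstanceAs (Ring (G → k))
instance : Algebra k (FunAlg G k) := inferInstanceAs (Algebra k (G → k))

variable [DecidableEq G]

/-- The canonical idempotent `e_g`, `e_g(h) = δ_{g,h}`. -/
def idem (k : Type u) [Field k] (g : G) : FunAlg G k := Pi.single (M := fun _ => k) g 1

theorem idem_orthogonal (a b : G) : idem k a * idem k b = if a = b then idem k a else 0 := by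
  funext c
  change (Pi.single (M := fun _ => k) a 1 : G → k) c * (Pi.single (M := fun _ => k) b 1 : G → k) c =
    (if a = b then idem k a else 0 : FunAlg G k) c
  split_ifs with h
  · subst h
    change _ = (Pi.single (M := fun _ => k) a 1 : G → k) c
    by_cases h1 : c = a <;> simp [h1]
  · change _ = (0 : k)
    by_cases h1 : c = a
    · subst h1; simp [h]
    · simp [h1]

variable [Fintype G]

theorem eq_sum (f : FunAlg G k) : f = ∑ g, f g • idem k g := by
  have h : ∀ f : G → k, f = ∑ g, f g • (Pi.single (M := fun _ => k) g 1 : G → k) := by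
    intro f
    funext c
    simp [Finset.sum_apply, Pi.single_apply]
  exact h f

theorem idem_complete : ∑ a : G, idem k a = 1 := by
  rw [eq_sum (1 : FunAlg G k)]
  exact Finset.sum_congr rfl fun g _ => (one_smul k _).symm

variable [Group G]

/-- The comultiplication of `k^G`: `Δ(f)(s, t) = f(st)`. -/
def comul (G : Type v) (k : Type u) [Group G] [Fintype G] [DecidableEq G] [Field k] :
    FunAlg G k →ₐ[k] FunAlg G k ⊗[k] FunAlg G k :=
  AlgHom.ofLinearMap
    { toFun := fun f => ∑ p : G × G, f (p.1 * p.2) • (idem k p.1 ⊗ₜ[k] idem k p.2)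
      map_add' := fun f g => by
        rw [← Finset.sum_add_distrib]
        exact Finset.sum_congr rfl fun p _ => add_smul _ _ _
      map_smul' := fun c f => by
        rw [Finset.smul_sum]
        exact Finset.sum_congr rfl fun p _ => mul_smul c _ _ }
    (by
      change ∑ p : G × G, (1 : k) • (idem k p.1 ⊗ₜ[k] idem k p.2) = 1
      simp only [one_smul, Fintype.sum_prod_type, ← TensorProduct.tmul_sum,
        ← TensorProduct.sum_tmul, idem_complete]
      rfl)
    (fun f g => (sum_smul_mul (E := fun p : G × G => idem k p.1 ⊗ₜ[k] idem k p.2)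
      (tmul_orthogonal idem_orthogonal idem_orthogonal) _ _).symm)

theorem comul_apply (f : FunAlg G k) :
    comul G k f = ∑ s, ∑ t, f (s * t) • (idem k s ⊗ₜ[k] idem k t) :=
  Fintype.sum_prod_type _

theorem comul_idem (g : G) : comul G k (idem k g) = ∑ s, idem k s ⊗ₜ[k] idem k (s⁻¹ * g) := by
  change ∑ p : G × G, (Pi.single (M := fun _ => k) g 1 : G → k) (p.1 * p.2) •
    (idem k p.1 ⊗ₜ[k] idem k p.2) = _
  rw [Fintype.sum_prod_type]
  refine Finset.sum_congr rfl fun s _ => ?_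
  rw [Finset.sum_eq_single (s⁻¹ * g)]
  · simp
  · intro t _ ht
    have : s * t ≠ g := fun h => ht (by rw [← h]; simp)
    simp [Pi.single_apply, this]
  · simp

/-- The counit of `k^G`: evaluation at the identity. -/
def counit (G : Type v) (k : Type u) [Group G] [Field k] : FunAlg G k →ₐ[k] k :=
  Pi.evalAlgHom k (fun _ : G => k) 1

theorem counit_idem (g : G) : counit G k (idem k g) = if g = 1 then 1 else 0 := by
  change (Pi.single (M := fun _ => k) g 1 : G → k) 1 = _
  simp [Pi.single_apply, eq_comm]

theorem counit_comul (h : FunAlg G k) :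
    Algebra.TensorProduct.lid k _ (Algebra.TensorProduct.map (counit G k) (AlgHom.id k _)
      (comul G k h)) = h := by
  have h1 : ∀ g, Algebra.TensorProduct.lid k _
      (Algebra.TensorProduct.map (counit G k) (AlgHom.id k _) (comul G k (idem k g))) =
        idem k g := by
    intro g
    simp [comul_idem, counit_idem]
  rw [eq_sum h]
  simp only [map_sum, map_smul, h1]

theorem comul_counit (h : FunAlg G k) :
    Algebra.TensorProduct.rid k k _ (Algebra.TensorProduct.map (AlgHom.id k _) (counit G k)
      (comul G k h)) = h := by
  have h1 : ∀ g, Algebra.TensorProduct.rid k k _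
      (Algebra.TensorProduct.map (AlgHom.id k _) (counit G k) (comul G k (idem k g))) =
        idem k g := by
    intro g
    simp [comul_idem, counit_idem, inv_mul_eq_one]
  rw [eq_sum h]
  simp only [map_sum, map_smul, h1]

theorem comul_coassoc (φ : G → G → G → k) (h : FunAlg G k) :
    Algebra.TensorProduct.map (AlgHom.id k _) (comul G k) (comul G k h) * diag₃ (idem k) φ =
      diag₃ (idem k) φ * Algebra.TensorProduct.assoc k k k _ _ _
        (Algebra.TensorProduct.map (comul G k) (AlgHom.id k _) (comul G k h)) := by
  have h1 : Algebra.TensorProduct.map (AlgHom.id k _) (comul G k) (comul G k h) =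
      diag₃ (idem k) (fun a b c => h (a * (b * c))) := by
    simp only [comul_apply h, map_sum, map_smul, Algebra.TensorProduct.map_tmul, AlgHom.coe_id,
      id_eq, comul_idem, TensorProduct.tmul_sum, Finset.smul_sum, diag₃, Fintype.sum_prod_type]
    exact Finset.sum_congr rfl fun a _ =>
      sum_convolution (fun c s t => h (a * c) • (idem k a ⊗ₜ[k] (idem k s ⊗ₜ[k] idem k t)))
  have h2 : Algebra.TensorProduct.assoc k k k _ _ _
        (Algebra.TensorProduct.map (comul G k) (AlgHom.id k _) (comul G k h)) =
      diag₃ (idem k) (fun a b c => h (a * b * c)) := by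
    simp only [comul_apply h, map_sum, map_smul, Algebra.TensorProduct.map_tmul, AlgHom.coe_id,
      id_eq, comul_idem, TensorProduct.sum_tmul, Finset.smul_sum, diag₃, Fintype.sum_prod_type,
      Algebra.TensorProduct.assoc_tmul]
    exact (Finset.sum_congr rfl fun a _ => Finset.sum_comm).trans (sum_convolution
      (fun a s t => ∑ c, h (a * c) • (idem k s ⊗ₜ[k] (idem k t ⊗ₜ[k] idem k c))))
  rw [h1, h2, diag₃_mul idem_orthogonal, diag₃_mul idem_orthogonal]
  congr 1
  funext a b c
  rw [mul_comm, mul_assoc]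

theorem pentagon' (ω : Cocycle3 G k) :
    (1 ⊗ₜ[k] (diagUnit (e := idem k) idem_orthogonal idem_complete ω.toFun).1) *
      Algebra.TensorProduct.map (AlgHom.id k (FunAlg G k))
        ((Algebra.TensorProduct.assoc k k k (FunAlg G k) (FunAlg G k) (FunAlg G k)).toAlgHom.comp
          (Algebra.TensorProduct.map (comul G k) (AlgHom.id k (FunAlg G k))))
        (diagUnit (e := idem k) idem_orthogonal idem_complete ω.toFun).1 *
      Algebra.TensorProduct.map (AlgHom.id k (FunAlg G k))
        (Algebra.TensorProduct.assoc k k k (FunAlg G k) (FunAlg G k) (FunAlg G k)).toAlgHom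
        (Algebra.TensorProduct.assoc k k k (FunAlg G k) ((FunAlg G k) ⊗[k] (FunAlg G k)) (FunAlg G k)
          ((diagUnit (e := idem k) idem_orthogonal idem_complete ω.toFun).1 ⊗ₜ[k] 1)) =
    Algebra.TensorProduct.map (AlgHom.id k (FunAlg G k)) (Algebra.TensorProduct.map (AlgHom.id k (FunAlg G k)) (comul G k))
        (diagUnit (e := idem k) idem_orthogonal idem_complete ω.toFun).1 *
      Algebra.TensorProduct.assoc k k k (FunAlg G k) (FunAlg G k) ((FunAlg G k) ⊗[k] (FunAlg G k))
        (Algebra.TensorProduct.map (comul G k) (AlgHom.id k ((FunAlg G k) ⊗[k] (FunAlg G k)))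
          (diagUnit (e := idem k) idem_orthogonal idem_complete ω.toFun).1) := by
  have h := fun a b c d => congrArg (fun x : kˣ => (x : k)) (ω.cocycle a b c d)
  simp only [Units.val_mul] at h
  exact diag_pentagon (e := idem k) idem_orthogonal idem_complete ((comul G k)) comul_idem (fun a b c => (ω.toFun a b c : k))
    fun a b c d => (h a b c d).trans (mul_comm _ _)

theorem triangle' (ω : Cocycle3 G k) :
    Algebra.TensorProduct.map (AlgHom.id k (FunAlg G k))
      ((Algebra.TensorProduct.lid k (FunAlg G k)).toAlgHom.comp
        (Algebra.TensorProduct.map (counit G k) (AlgHom.id k (FunAlg G k))))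
        (diagUnit (e := idem k) idem_orthogonal idem_complete ω.toFun).1 = 1 :=
  diag_triangle (e := idem k) idem_complete (counit G k) counit_idem (fun a b c => (ω.toFun a b c : k)) fun a c => by simp [ω.one_mid]

/-- The quasi-Hopf algebra `(k^G, ω)`, with associator `∑ ω(a, b, c) e_a ⊗ e_b ⊗ e_c`. -/
def quasiBialgebra (ω : Cocycle3 G k) : QuasiBialgebra k (FunAlg G k) where
  Δ := comul G k
  ε := counit G k
  φ := diagUnit idem_orthogonal idem_complete ω.toFun
  coassoc h := comul_coassoc (fun a b c => (ω.toFun a b c : k)) h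
  counit_left h := counit_comul h
  counit_right h := comul_counit h
  pentagon := pentagon' ω
  triangle := triangle' ω

end FunAlg
end FunctionAlgebra

section Double

variable {G : Type v} {k : Type u} [Group G] [Field k]

/-- The underlying space of `D^ω G`, with basis indexed by `G × G`. -/
def TwistedDouble (_ω : Cocycle3 G k) : Type (max u v) := (G × G) →₀ k

namespace TwistedDouble

variable (ω : Cocycle3 G k)

instance : AddCommGroup (TwistedDouble ω) := inferInstanceAs (AddCommGroup ((G × G) →₀ k))
instance : Module k (TwistedDouble ω) := inferInstanceAs (Module k ((G × G) →₀ k))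

/-- The basis element `e_g # x`. -/
def bas (g x : G) : TwistedDouble ω := Finsupp.single (g, x) 1

/-- The linear map with prescribed values on the basis `e_g # x`. -/
def lift {M : Type*} [AddCommGroup M] [Module k M] (f : G → G → M) : TwistedDouble ω →ₗ[k] M :=
  Finsupp.linearCombination k (fun p : G × G => f p.1 p.2)

variable {ω}

@[simp] theorem lift_bas {M : Type*} [AddCommGroup M] [Module k M] (f : G → G → M) (g x : G) :
    lift ω f (bas ω g x) = f g x :=
  (Finsupp.linearCombination_single k _ _).trans (one_smul k _)

theorem lin_ext {M : Type*} [AddCommGroup M] [Module k M] {f f' : TwistedDouble ω →ₗ[k] M}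
    (h : ∀ g x, f (bas ω g x) = f' (bas ω g x)) : f = f' :=
  Finsupp.lhom_ext' fun p => LinearMap.ext_ring (h p.1 p.2)

theorem induct {P : TwistedDouble ω → Prop} (h0 : P 0) (ha : ∀ a b, P a → P b → P (a + b))
    (hb : ∀ (c : k) (g x : G), P (c • bas ω g x)) (a : TwistedDouble ω) : P a := by
  refine Finsupp.induction_linear (motive := P) a h0 ha fun p c => ?_
  have h : (c • bas ω p.1 p.2) = (Finsupp.single p c : (G × G) →₀ k) :=
    (Finsupp.smul_single c p (1 : k)).trans (by rw [smul_eq_mul, mul_one])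
  exact h ▸ hb c p.1 p.2

variable [Fintype G] [DecidableEq G]

/-- The multiplication of `D^ω G`:
`(e_g # x)(e_h # y) = δ_{g, xhx⁻¹} θ_g(x, y) e_g # xy`. -/
def mulLin (ω : Cocycle3 G k) : TwistedDouble ω →ₗ[k] TwistedDouble ω →ₗ[k] TwistedDouble ω :=
  lift ω fun g x => lift ω fun h y =>
    if g = x * h * x⁻¹ then (ω.θ g x y : k) • bas ω g (x * y) else 0

theorem mulLin_bas (g x h y : G) : mulLin ω (bas ω g x) (bas ω h y) =
    if g = x * h * x⁻¹ then (ω.θ g x y : k) • bas ω g (x * y) else 0 := by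
  simp [mulLin]

theorem mulLin_assoc_bas (g x h y l z : G) :
    mulLin ω (mulLin ω (bas ω g x) (bas ω h y)) (bas ω l z) =
      mulLin ω (bas ω g x) (mulLin ω (bas ω h y) (bas ω l z)) := by
  rw [mulLin_bas, mulLin_bas]
  by_cases h1 : g = x * h * x⁻¹
  · by_cases h2 : h = y * l * y⁻¹
    · have h3 : g = x * y * l * (x * y)⁻¹ := by rw [h1, h2]; simp [mul_assoc]
      have h4 : x⁻¹ * g * x = h := by rw [h1]; simp [mul_assoc]
      have := congrArg (fun x : kˣ => (x : k)) (ω.θ_mul g x y z)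
      simp only [Units.val_mul, h4] at this
      rw [if_pos h1, if_pos h2, map_smul, map_smul, LinearMap.smul_apply, mulLin_bas, mulLin_bas,
        if_pos h1, if_pos h3, smul_smul, smul_smul, this, mul_assoc, mul_comm]
    · have h3 : ¬ g = x * y * l * (x * y)⁻¹ := by
        intro e
        apply h2
        rw [e] at h1
        have := congrArg (fun w => x⁻¹ * w * x) h1
        simp only [mul_assoc, mul_inv_rev, inv_mul_cancel_left, inv_mul_cancel, mul_one] at this
        rw [← this, mul_assoc]
      rw [if_pos h1, if_neg h2, map_smul, LinearMap.smul_apply, mulLin_bas, if_neg h3, smul_zero,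
        map_zero]
  · rw [if_neg h1, map_zero, LinearMap.zero_apply]
    split_ifs
    · rw [map_smul, mulLin_bas, if_neg h1, smul_zero]
    · rw [map_zero]

theorem mulLin_assoc (a b c : TwistedDouble ω) :
    mulLin ω (mulLin ω a b) c = mulLin ω a (mulLin ω b c) := by
  induction a using induct with
  | h0 => simp
  | ha a a' h h' => simp only [map_add, LinearMap.add_apply, h, h']
  | hb r g x =>
  induction b using induct with
  | h0 => simp
  | ha a a' h h' => simp only [map_add, LinearMap.add_apply, h, h']
  | hb s h y =>
  induction c using induct with
  | h0 => simp
  | ha a a' h h' => simp only [map_add, h, h']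
  | hb t l z =>
  simp only [map_smul, LinearMap.smul_apply, mulLin_assoc_bas, smul_smul]
  congr 1
  ring

instance : Mul (TwistedDouble ω) := ⟨fun a b => mulLin ω a b⟩
instance : One (TwistedDouble ω) := ⟨∑ g, bas ω g 1⟩

theorem mul_def (a b : TwistedDouble ω) : a * b = mulLin ω a b := rfl
theorem one_def : (1 : TwistedDouble ω) = ∑ g, bas ω g 1 := rfl

theorem bas_mul_bas (g x h y : G) : bas ω g x * bas ω h y =
    if g = x * h * x⁻¹ then (ω.θ g x y : k) • bas ω g (x * y) else 0 :=
  mulLin_bas g x h y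

theorem mulLin_one_left (a : TwistedDouble ω) : mulLin ω (∑ g, bas ω g 1) a = a := by
  have : mulLin ω (∑ g, bas ω g 1) = LinearMap.id := by
    refine lin_ext fun g x => ?_
    simp [LinearMap.sum_apply, mulLin_bas]
  rw [this]; rfl

theorem mulLin_one_right (a : TwistedDouble ω) : mulLin ω a (∑ g, bas ω g 1) = a := by
  have : (mulLin ω).flip (∑ g, bas ω g 1) = LinearMap.id := by
    refine lin_ext fun g x => ?_
    rw [LinearMap.flip_apply, map_sum, Finset.sum_eq_single (x⁻¹ * g * x)]
    · simp [mulLin_bas, mul_assoc]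
    · intro h _ hne
      rw [mulLin_bas, if_neg]
      intro e
      apply hne
      rw [e]; simp [mul_assoc]
    · simp
  exact LinearMap.congr_fun this a

instance : Ring (TwistedDouble ω) :=
  { (inferInstance : AddCommGroup (TwistedDouble ω)) with
    mul := fun a b => mulLin ω a b
    one := ∑ g, bas ω g 1
    zero_mul := fun a => by simp [mul_def]
    mul_zero := fun a => by simp [mul_def]
    left_distrib := fun a b c => by simp [mul_def]
    right_distrib := fun a b c => by simp [mul_def]
    mul_assoc := mulLin_assoc
    one_mul := mulLin_one_left
    mul_one := mulLin_one_right }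

instance : Algebra k (TwistedDouble ω) :=
  Algebra.ofModule (fun c a b => by simp [mul_def]) (fun c a b => by simp [mul_def])


/-- The comultiplication of `D^ω G`:
`Δ(e_g # x) = ∑_{st = g} γ_x(s, t) (e_s # x) ⊗ (e_t # x)`. -/
def comulLin (ω : Cocycle3 G k) : TwistedDouble ω →ₗ[k] TwistedDouble ω ⊗[k] TwistedDouble ω :=
  lift ω fun g x => ∑ s, (ω.γ x s (s⁻¹ * g) : k) • (bas ω s x ⊗ₜ[k] bas ω (s⁻¹ * g) x)

theorem comulLin_bas (g x : G) : comulLin ω (bas ω g x) =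
    ∑ s, (ω.γ x s (s⁻¹ * g) : k) • (bas ω s x ⊗ₜ[k] bas ω (s⁻¹ * g) x) := lift_bas _ _ _

theorem comulLin_one : comulLin ω 1 = 1 := by
  simp only [one_def, map_sum, comulLin_bas]
  rw [sum_convolution (fun _ s t => (ω.γ 1 s t : k) • (bas ω s 1 ⊗ₜ[k] bas ω t 1))]
  simp only [Cocycle3.γ_one, Units.val_one, one_smul, ← TensorProduct.tmul_sum,
    ← TensorProduct.sum_tmul]
  rfl

theorem comulLin_mul (a b : TwistedDouble ω) :
    comulLin ω (a * b) = comulLin ω a * comulLin ω b := by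
  induction a using induct with
  | h0 => simp
  | ha a a' h h' => simp only [add_mul, map_add, h, h']
  | hb r g x =>
  induction b using induct with
  | h0 => simp
  | ha a a' h h' => simp only [mul_add, map_add, h, h']
  | hb s h y =>
  rw [smul_mul_smul_comm, map_smul, map_smul, map_smul, smul_mul_smul_comm]
  congr 1
  rw [bas_mul_bas, comulLin_bas, comulLin_bas, Finset.sum_mul_sum]
  simp only [smul_mul_smul_comm, Algebra.TensorProduct.tmul_mul_tmul, bas_mul_bas]
  have hcol : ∀ s, ∑ t, ((ω.γ x s (s⁻¹ * g) : k) * (ω.γ y t (t⁻¹ * h) : k)) •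
      ((if s = x * t * x⁻¹ then (ω.θ s x y : k) • bas ω s (x * y) else 0) ⊗ₜ[k]
      (if s⁻¹ * g = x * (t⁻¹ * h) * x⁻¹ then
        (ω.θ (s⁻¹ * g) x y : k) • bas ω (s⁻¹ * g) (x * y) else 0)) =
      if g = x * h * x⁻¹ then (ω.θ g x y : k) • (ω.γ (x * y) s (s⁻¹ * g) : k) •
        (bas ω s (x * y) ⊗ₜ[k] bas ω (s⁻¹ * g) (x * y)) else 0 := by
    intro s
    rw [Finset.sum_eq_single (x⁻¹ * s * x)]
    · have e1 : s = x * (x⁻¹ * s * x) * x⁻¹ := by simp [mul_assoc]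
      rw [if_pos e1]
      have e2 : (s⁻¹ * g = x * ((x⁻¹ * s * x)⁻¹ * h) * x⁻¹) ↔ g = x * h * x⁻¹ := by
        rw [inv_mul_eq_iff_eq_mul]
        simp [mul_assoc]
      by_cases hg : g = x * h * x⁻¹
      · rw [if_pos (e2.2 hg), if_pos hg]
        have := congrArg (fun x : kˣ => (x : k)) (ω.θ_γ s (s⁻¹ * g) x y)
        have e3 : (x⁻¹ * s * x)⁻¹ * h = x⁻¹ * (s⁻¹ * g) * x := by rw [hg]; simp [mul_assoc]
        simp only [Units.val_mul, mul_inv_cancel_left] at this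
        rw [TensorProduct.smul_tmul_smul, smul_smul, smul_smul, this, e3]
        congr 1
        ring
      · rw [if_neg (fun h' => hg (e2.1 h')), if_neg hg, TensorProduct.tmul_zero, smul_zero]
    · intro t _ ht
      rw [if_neg, TensorProduct.zero_tmul, smul_zero]
      intro e
      apply ht
      rw [e]; simp [mul_assoc]
    · simp
  simp only [hcol]
  split_ifs with hg
  · rw [map_smul, comulLin_bas, Finset.smul_sum]
  · simp

/-- The comultiplication as an algebra map. -/
def comul (ω : Cocycle3 G k) : TwistedDouble ω →ₐ[k] TwistedDouble ω ⊗[k] TwistedDouble ω :=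
  AlgHom.ofLinearMap (comulLin ω) comulLin_one comulLin_mul

theorem comul_bas (g x : G) : comul ω (bas ω g x) =
    ∑ s, (ω.γ x s (s⁻¹ * g) : k) • (bas ω s x ⊗ₜ[k] bas ω (s⁻¹ * g) x) := comulLin_bas g x

/-- The counit of `D^ω G`: `ε(e_g # x) = δ_{g, 1}`. -/
def counit (ω : Cocycle3 G k) : TwistedDouble ω →ₐ[k] k :=
  AlgHom.ofLinearMap (lift ω fun g _ => if g = 1 then 1 else 0)
    (by simp [one_def])
    (fun a b => by
      induction a using induct with
      | h0 => simp
      | ha a a' h h' => simp only [add_mul, map_add, h, h']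
      | hb r g x =>
      induction b using induct with
      | h0 => simp
      | ha a a' h h' => simp only [mul_add, map_add, h, h']
      | hb s h y =>
      rw [smul_mul_smul_comm, map_smul, map_smul, map_smul, smul_mul_smul_comm]
      congr 1
      rw [bas_mul_bas, lift_bas, lift_bas]
      by_cases hg : g = x * h * x⁻¹
      · rw [if_pos hg, map_smul, lift_bas]
        by_cases hh : h = 1
        · subst hh; simp at hg; subst hg; simp
        · have : g ≠ 1 := by
            rintro rfl
            apply hh
            simpa [mul_assoc] using (congrArg (fun w => x⁻¹ * (w * x)) hg).symm
          simp [this]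
      · rw [if_neg hg, map_zero]
        by_cases hh : h = 1
        · subst hh; simp at hg; simp [hg]
        · simp [hh])

theorem counit_bas (g x : G) : counit ω (bas ω g x) = if g = 1 then 1 else 0 :=
  lift_bas (fun g _ => if g = 1 then (1 : k) else 0) g x

theorem idem_orthogonal (a b : G) :
    bas ω a 1 * bas ω b 1 = if a = b then bas ω a 1 else 0 := by
  simp [bas_mul_bas]

theorem comul_idem (g : G) : comul ω (bas ω g 1) =
    ∑ s, bas ω s 1 ⊗ₜ[k] bas ω (s⁻¹ * g) 1 := by
  simp [comul_bas]

theorem counit_comul (h : TwistedDouble ω) :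
    Algebra.TensorProduct.lid k _ (Algebra.TensorProduct.map (counit ω) (AlgHom.id k _)
      (comul ω h)) = h := by
  induction h using induct with
  | h0 => simp
  | ha a a' h h' => simp only [map_add, h, h']
  | hb r g x =>
  rw [map_smul, map_smul, map_smul]
  congr 1
  simp [comul_bas, counit_bas]

theorem comul_counit (h : TwistedDouble ω) :
    Algebra.TensorProduct.rid k k _ (Algebra.TensorProduct.map (AlgHom.id k _) (counit ω)
      (comul ω h)) = h := by
  induction h using induct with
  | h0 => simp
  | ha a a' h h' => simp only [map_add, h, h']
  | hb r g x =>
  rw [map_smul, map_smul, map_smul]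
  congr 1
  simp [comul_bas, counit_bas, inv_mul_eq_one]

theorem bas_one_mul (a g x : G) : bas ω a 1 * bas ω g x = if a = g then bas ω g x else 0 := by
  rw [bas_mul_bas]
  by_cases h : a = g <;> simp [h]

theorem bas_mul_one (a g x : G) :
    bas ω g x * bas ω a 1 = if a = x⁻¹ * g * x then bas ω g x else 0 := by
  rw [bas_mul_bas]
  have : (g = x * a * x⁻¹) ↔ (a = x⁻¹ * g * x) := by
    rw [eq_mul_inv_iff_mul_eq, eq_comm, ← eq_inv_mul_iff_mul_eq, mul_assoc]
  by_cases h : g = x * a * x⁻¹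
  · rw [if_pos h, if_pos (this.1 h)]; simp
  · rw [if_neg h, if_neg (fun h' => h (this.2 h'))]

theorem diag_mul_bas (F : G → G → G → k) (a b c x : G) :
    diag₃ (fun g => bas ω g 1) F * (bas ω a x ⊗ₜ[k] (bas ω b x ⊗ₜ[k] bas ω c x)) =
      F a b c • (bas ω a x ⊗ₜ[k] (bas ω b x ⊗ₜ[k] bas ω c x)) := by
  refine sum_smul_mul_single (E := fun p : G × G × G =>
    bas ω p.1 1 ⊗ₜ[k] (bas ω p.2.1 1 ⊗ₜ[k] bas ω p.2.2 1)) (a, b, c) ?_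
    (fun p => F p.1 p.2.1 p.2.2)
  rintro ⟨a', b', c'⟩
  rw [Algebra.TensorProduct.tmul_mul_tmul, Algebra.TensorProduct.tmul_mul_tmul, bas_one_mul,
    bas_one_mul, bas_one_mul]
  by_cases h1 : a' = a <;> by_cases h2 : b' = b <;> by_cases h3 : c' = c <;> simp [h1, h2, h3]

theorem bas_mul_diag (F : G → G → G → k) (a b c x : G) :
    (bas ω a x ⊗ₜ[k] (bas ω b x ⊗ₜ[k] bas ω c x)) * diag₃ (fun g => bas ω g 1) F =
      F (x⁻¹ * a * x) (x⁻¹ * b * x) (x⁻¹ * c * x) •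
        (bas ω a x ⊗ₜ[k] (bas ω b x ⊗ₜ[k] bas ω c x)) := by
  refine mul_sum_smul_single (E := fun p : G × G × G =>
    bas ω p.1 1 ⊗ₜ[k] (bas ω p.2.1 1 ⊗ₜ[k] bas ω p.2.2 1))
    (x⁻¹ * a * x, x⁻¹ * b * x, x⁻¹ * c * x) ?_ (fun p => F p.1 p.2.1 p.2.2)
  rintro ⟨a', b', c'⟩
  rw [Algebra.TensorProduct.tmul_mul_tmul, Algebra.TensorProduct.tmul_mul_tmul, bas_mul_one,
    bas_mul_one, bas_mul_one]
  by_cases h1 : a' = x⁻¹ * a * x <;> by_cases h2 : b' = x⁻¹ * b * x <;>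
    by_cases h3 : c' = x⁻¹ * c * x <;> simp [h1, h2, h3]

theorem comul_coassoc (h : TwistedDouble ω) :
    Algebra.TensorProduct.map (AlgHom.id k _) (comul ω) (comul ω h) *
        diag₃ (fun g => bas ω g 1) (fun a b c => (((ω.toFun a b c)⁻¹ : kˣ) : k)) =
      diag₃ (fun g => bas ω g 1) (fun a b c => (((ω.toFun a b c)⁻¹ : kˣ) : k)) *
        Algebra.TensorProduct.assoc k k k _ _ _
          (Algebra.TensorProduct.map (comul ω) (AlgHom.id k _) (comul ω h)) := by
  induction h using induct with
  | h0 => simp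
  | ha a a' h h' => simp only [map_add, add_mul, mul_add, h, h']
  | hb r g x =>
  rw [map_smul, map_smul, map_smul, map_smul, smul_mul_assoc, mul_smul_comm]
  congr 1
  have h1 : Algebra.TensorProduct.map (AlgHom.id k _) (comul ω) (comul ω (bas ω g x)) =
      ∑ s, ∑ t, ((ω.γ x s (s⁻¹ * g) : k) * (ω.γ x t (t⁻¹ * (s⁻¹ * g)) : k)) •
        (bas ω s x ⊗ₜ[k] (bas ω t x ⊗ₜ[k] bas ω (t⁻¹ * (s⁻¹ * g)) x)) := by
    simp only [comul_bas, map_sum, map_smul, Algebra.TensorProduct.map_tmul, AlgHom.coe_id, id_eq,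
      TensorProduct.tmul_sum, TensorProduct.tmul_smul, Finset.smul_sum, smul_smul]
  have h2 : Algebra.TensorProduct.assoc k k k _ _ _
        (Algebra.TensorProduct.map (comul ω) (AlgHom.id k _) (comul ω (bas ω g x))) =
      ∑ s, ∑ t, ((ω.γ x (s * t) ((s * t)⁻¹ * g) : k) * (ω.γ x s t : k)) •
        (bas ω s x ⊗ₜ[k] (bas ω t x ⊗ₜ[k] bas ω ((s * t)⁻¹ * g) x)) := by
    simp only [comul_bas, map_sum, map_smul, Algebra.TensorProduct.map_tmul, AlgHom.coe_id, id_eq,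
      TensorProduct.sum_tmul, ← TensorProduct.smul_tmul', Finset.smul_sum, smul_smul,
      Algebra.TensorProduct.assoc_tmul]
    exact sum_convolution (fun b s t => ((ω.γ x b (b⁻¹ * g) : k) * (ω.γ x s t : k)) •
        (bas ω s x ⊗ₜ[k] (bas ω t x ⊗ₜ[k] bas ω (b⁻¹ * g) x)))
  rw [h1, h2, Finset.sum_mul, Finset.mul_sum]
  refine Finset.sum_congr rfl fun s _ => ?_
  rw [Finset.sum_mul, Finset.mul_sum]
  refine Finset.sum_congr rfl fun t _ => ?_
  have e : (s * t)⁻¹ * g = t⁻¹ * (s⁻¹ * g) := by simp [mul_assoc]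
  rw [e, smul_mul_assoc, mul_smul_comm, diag_mul_bas, bas_mul_diag, smul_smul, smul_smul]
  congr 1
  have := ω.γ_mul x s t (t⁻¹ * (s⁻¹ * g))
  rw [mul_inv_cancel_left] at this
  simp only [← Units.val_mul]
  congr 1
  rw [mul_inv_eq_iff_eq_mul, mul_right_comm, eq_mul_inv_iff_mul_eq,
    mul_comm (ω.γ x s (s⁻¹ * g)), this, mul_comm (ω.γ x s t)]

theorem pentagon' (ω : Cocycle3 G k) :
    (1 ⊗ₜ[k] (diagUnit (e := fun g => bas ω g 1) idem_orthogonal one_def.symm (fun a b c => (ω.toFun a b c)⁻¹)).1) *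
      Algebra.TensorProduct.map (AlgHom.id k (TwistedDouble ω))
        ((Algebra.TensorProduct.assoc k k k (TwistedDouble ω) (TwistedDouble ω) (TwistedDouble ω)).toAlgHom.comp
          (Algebra.TensorProduct.map (comul ω) (AlgHom.id k (TwistedDouble ω))))
        (diagUnit (e := fun g => bas ω g 1) idem_orthogonal one_def.symm (fun a b c => (ω.toFun a b c)⁻¹)).1 *
      Algebra.TensorProduct.map (AlgHom.id k (TwistedDouble ω))
        (Algebra.TensorProduct.assoc k k k (TwistedDouble ω) (TwistedDouble ω) (TwistedDouble ω)).toAlgHom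
        (Algebra.TensorProduct.assoc k k k (TwistedDouble ω) ((TwistedDouble ω) ⊗[k] (TwistedDouble ω)) (TwistedDouble ω)
          ((diagUnit (e := fun g => bas ω g 1) idem_orthogonal one_def.symm (fun a b c => (ω.toFun a b c)⁻¹)).1 ⊗ₜ[k] 1)) =
    Algebra.TensorProduct.map (AlgHom.id k (TwistedDouble ω)) (Algebra.TensorProduct.map (AlgHom.id k (TwistedDouble ω)) (comul ω))
        (diagUnit (e := fun g => bas ω g 1) idem_orthogonal one_def.symm (fun a b c => (ω.toFun a b c)⁻¹)).1 *
      Algebra.TensorProduct.assoc k k k (TwistedDouble ω) (TwistedDouble ω) ((TwistedDouble ω) ⊗[k] (TwistedDouble ω))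
        (Algebra.TensorProduct.map (comul ω) (AlgHom.id k ((TwistedDouble ω) ⊗[k] (TwistedDouble ω)))
          (diagUnit (e := fun g => bas ω g 1) idem_orthogonal one_def.symm (fun a b c => (ω.toFun a b c)⁻¹)).1) := by
  have h := fun a b c d => congrArg (fun x : kˣ => ((x⁻¹ : kˣ) : k)) (ω.cocycle a b c d)
  simp only [mul_inv, Units.val_mul] at h
  exact diag_pentagon (e := fun g => bas ω g 1) idem_orthogonal one_def.symm ((comul ω)) comul_idem (fun a b c => (((ω.toFun a b c)⁻¹ : kˣ) : k))
    fun a b c d => (h a b c d).trans (mul_comm _ _)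

theorem triangle' (ω : Cocycle3 G k) :
    Algebra.TensorProduct.map (AlgHom.id k (TwistedDouble ω))
      ((Algebra.TensorProduct.lid k (TwistedDouble ω)).toAlgHom.comp
        (Algebra.TensorProduct.map (counit ω) (AlgHom.id k (TwistedDouble ω))))
        (diagUnit (e := fun g => bas ω g 1) idem_orthogonal one_def.symm (fun a b c => (ω.toFun a b c)⁻¹)).1 = 1 :=
  diag_triangle (e := fun g => bas ω g 1) one_def.symm (counit ω) (fun g => counit_bas g 1) (fun a b c => (((ω.toFun a b c)⁻¹ : kˣ) : k)) fun a c => by simp [ω.one_mid]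

/-- The twisted quantum double `D^ω G`, with associator
`∑ ω(a, b, c)⁻¹ e_a ⊗ e_b ⊗ e_c`. -/
def quasiBialgebra (ω : Cocycle3 G k) : QuasiBialgebra k (TwistedDouble ω) where
  Δ := comul ω
  ε := counit ω
  φ := diagUnit (e := fun g => bas ω g 1) idem_orthogonal one_def.symm
    (fun a b c => (ω.toFun a b c)⁻¹)
  coassoc h := comul_coassoc h
  counit_left h := counit_comul h
  counit_right h := comul_counit h
  pentagon := pentagon' ω
  triangle := triangle' ω

end TwistedDouble
end Double

/-- The standard 3-cocycle `ω_ζ` on the cyclic group `C_n`, written as `Multiplicative (ZMod n)` with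
generator `a`: for `0 ≤ i, j, l < n`, `ω(a^i, a^j, a^l) = ζ^(l q)`, where `q` is the quotient of
`i + j` in the division by `n`. -/
def cyclicCocycle {k : Type u} [Field k] (n : ℕ) [NeZero n] (ζ : kˣ) (hζ : ζ ^ n = 1) :
    Cocycle3 (Multiplicative (ZMod n)) k where
  toFun x y z := ζ ^ (z.toAdd.val * ((x.toAdd.val + y.toAdd.val) / n))
  cocycle x y z t := by
    simp only [toAdd_mul, ZMod.val_add]
    generalize x.toAdd.val = a
    generalize y.toAdd.val = b
    generalize z.toAdd.val = c
    generalize t.toAdd.val = d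
    have hn : 0 < n := Nat.pos_of_ne_zero (NeZero.ne n)
    have key : (b + c) / n + (a + (b + c) % n) / n = (a + b) / n + ((a + b) % n + c) / n := by
      have h1 : (b + c) / n + (a + (b + c) % n) / n = (a + b + c) / n := by
        rw [← Nat.mul_add_div hn]
        congr 1
        have := Nat.div_add_mod (b + c) n
        omega
      have h2 : (a + b) / n + ((a + b) % n + c) / n = (a + b + c) / n := by
        rw [← Nat.mul_add_div hn]
        congr 1
        have := Nat.div_add_mod (a + b) n
        omega
      rw [h1, h2]
    rw [pow_mul ζ ((c + d) % n), ← pow_eq_pow_mod (c + d) hζ, ← pow_mul, ← pow_add, ← pow_add,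
      ← pow_add, ← mul_add, key]
    congr 1
    ring
  one_left y z := by
    simp [Nat.div_eq_of_lt (ZMod.val_lt _)]
  one_mid x z := by
    simp [Nat.div_eq_of_lt (ZMod.val_lt _)]
  one_right x y := by simp

end

end QuasiHopf

/-! Over both algebras every module is spanned by vectors on which the algebra acts through a
character, and the characters involved are closed under a commutative product. A `WeightSystem`
abstracts this situation. For an object X of the center, naturality reduces the half-braiding to
operators c_σ on X, one for each character σ. They preserve the weight spaces of X, and on weight ρ
the hexagon reads c_{στ} = h(ρ,σ,τ) c_τ c_σ, where h (`hexScalar`) is a quotient of three associator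
scalars.

Upper bound: iterating the hexagon gives c_{σ^N} = (product of hex scalars) c_σ^N. If every σ^N is
trivial and all these products are 1, then c_σ^N = id. Since β² acts on x ⊗ y, of weights ρ and σ,
as c_σ ⊗ c_ρ, it follows that (β²)^N = id (`doubleBraiding_unipotent`). For ω_ζ the hex scalars are
powers of ζ governed by carries modulo n, and the carries in repeatedly adding i to itself sum to
⌊Ni/n⌋ (`sum_carry`). Hence N = |ζ|n works for the double, and N = n² for (k^{C_n}, ω).

Lower bound: an element r of H whose weight values satisfy the hexagon makes a one-dimensional
module central (`CentralLine`). On two such objects β² is a scalar, which must be an N-th root of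
unity as soon as (β²)^N is unipotent (`CentralLine.pow_eq_one`). Fix ν with ν^n = ζ. For the double,
the scalars ν^i l with l^n = ζ^i occur. A primitive n-th root of unity (i = 0) forces n ∣ N. Then ν²
(i = 1, l = ν) gives ζ^(2N/n) = 1, and |ζ| being odd, |ζ| divides N/n. For (k^{C_n}, ω) the scalar
ν² also occurs; an exponent dividing n would give ζ² = 1, hence ζ = 1. -/

namespace QuasiHopf

noncomputable section

set_option linter.unusedSectionVars false

open CategoryTheory MonoidalCategory TensorProduct

/-! ### Characters of tensor products of algebras. -/

section CharTensor

variable {k : Type u} [Field k] {A B : Type*} [Ring A] [Algebra k A] [Ring B] [Algebra k B]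

/-- The product `χ ⊗ ψ` of two characters, as a character of the tensor product algebra. -/
def charTensor (χ : A →ₐ[k] k) (ψ : B →ₐ[k] k) : A ⊗[k] B →ₐ[k] k :=
  Algebra.TensorProduct.lift χ ψ fun _ _ => Commute.all _ _

@[simp] theorem charTensor_tmul (χ : A →ₐ[k] k) (ψ : B →ₐ[k] k) (a : A) (b : B) :
    charTensor χ ψ (a ⊗ₜ b) = χ a * ψ b := rfl

theorem tensorAct_apply_of_char {V W : Type u} [AddCommGroup V] [Module k V] [AddCommGroup W]
    [Module k W] {ρ : A →ₐ[k] Module.End k V} {σ : B →ₐ[k] Module.End k W} {χ : A →ₐ[k] k}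
    {ψ : B →ₐ[k] k} {v : V} {w : W} (hv : ∀ a, ρ a v = χ a • v) (hw : ∀ b, σ b w = ψ b • w)
    (t : A ⊗[k] B) : tensorAct ρ σ t (v ⊗ₜ w) = charTensor χ ψ t • (v ⊗ₜ w) := by
  induction t with
  | zero => simp
  | add x y hx hy => simp only [map_add, LinearMap.add_apply, hx, hy, add_smul]
  | tmul a b =>
    rw [tensorAct_tmul, TensorProduct.map_tmul, hv, hw, charTensor_tmul, smul_tmul_smul]

end CharTensor

variable {k : Type u} {H : Type w} [Field k] [Ring H] [Algebra k H]

/-! ### Weight spaces and one-dimensional representations. -/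

namespace FinRep

variable {B : QuasiBialgebra k H}

/-- The vectors on which `H` acts through the character `χ`. -/
def weightSpace (M : FinRep B) (χ : H →ₐ[k] k) : Submodule k M.V where
  carrier := {v | ∀ h, M.ρ h v = χ h • v}
  add_mem' hv hw h := by rw [map_add, hv h, hw h, smul_add]
  zero_mem' h := by simp
  smul_mem' c v hv h := by rw [map_smul, hv h, smul_comm]

/-- The one-dimensional representation attached to a character. -/
abbrev line (B : QuasiBialgebra k H) (χ : H →ₐ[k] k) : FinRep B where
  V := k
  ρ := (Algebra.lmul k k).comp χ

theorem line_mem (χ : H →ₐ[k] k) (c : k) :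
    (show (line B χ).V from c) ∈ (line B χ).weightSpace χ := fun _ => rfl

/-- The morphism from a one-dimensional representation given by a weight vector. -/
def ofWeight {M : FinRep B} {χ : H →ₐ[k] k} {v : M.V} (hv : v ∈ M.weightSpace χ) :
    line B χ ⟶ M where
  lin := LinearMap.toSpanSingleton k M.V v
  comm h := by
    refine LinearMap.ext_ring ?_
    have : (χ h * 1) • v = M.ρ h ((1 : k) • v) := by rw [mul_one, one_smul, hv h]
    exact this

theorem ofWeight_apply {M : FinRep B} {χ : H →ₐ[k] k} {v : M.V} (hv : v ∈ M.weightSpace χ) :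
    (ofWeight hv).lin (1 : k) = v := one_smul k v

theorem lin_pow {M : FinRep B} (f : End M) (n : ℕ) :
    Hom.lin (f ^ n : End M) = ((Hom.lin f : Module.End k M.V) ^ n : Module.End k M.V) := by
  induction n with
  | zero => rfl
  | succ n ih => rw [pow_succ, pow_succ, ← ih]; rfl

theorem sub_one_lin {M : FinRep B} (f : End M) :
    Hom.lin (f - 1 : End M) = (Hom.lin f - 1 : Module.End k M.V) := by
  rw [sub_eq_add_neg, sub_eq_add_neg]; rfl

end FinRep

open FinRep

/-- A set of characters of `H`, closed under the tensor product, such that every representation is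
spanned by weight vectors for these characters. -/
structure WeightSystem (B : QuasiBialgebra k H) (W : Type*) [Mul W] [One W] where
  wt : W → H →ₐ[k] k
  wt_one : wt 1 = B.ε
  wt_mul : ∀ σ τ h, charTensor (wt σ) (wt τ) (B.Δ h) = wt (σ * τ) h
  mul_comm : ∀ σ τ : W, σ * τ = τ * σ
  translate_surjective : ∀ σ, Function.Surjective fun h : H =>
    Algebra.TensorProduct.lid k H (Algebra.TensorProduct.map (wt σ) (AlgHom.id k H) (B.Δ h))
  span_eq_top : ∀ M : FinRep B, Submodule.span k {v | ∃ σ, v ∈ M.weightSpace (wt σ)} = ⊤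

/-! ### Action of the associator on weight vectors. -/

namespace WeightSystem

variable {B : QuasiBialgebra k H} {W : Type*} [Mul W] [One W] (S : WeightSystem B W)

/-- The scalar by which the associator acts on a triple of weights. -/
def assocScalar (ρ σ τ : W) : kˣ :=
  Units.map (charTensor (S.wt ρ) (charTensor (S.wt σ) (S.wt τ))).toMonoidHom B.φ

/-- The failure of the half-braiding of an object of weight `ρ` to be multiplicative. -/
def hexScalar (ρ σ τ : W) : kˣ :=
  S.assocScalar σ ρ τ / (S.assocScalar ρ σ τ * S.assocScalar σ τ ρ)

variable {S}

theorem tmul_mem {M N : FinRep B} {σ τ : W} {x : M.V} {y : N.V}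
    (hx : x ∈ M.weightSpace (S.wt σ)) (hy : y ∈ N.weightSpace (S.wt τ)) :
    (show (M ⊗ N : FinRep B).V from x ⊗ₜ y) ∈ (M ⊗ N : FinRep B).weightSpace (S.wt (σ * τ)) := by
  intro h
  rw [← S.wt_mul σ τ h]
  exact tensorAct_apply_of_char hx hy (B.Δ h)

theorem linearMap_ext {M : FinRep B} {N : Type*} [AddCommGroup N] [Module k N]
    {f g : M.V →ₗ[k] N} (S : WeightSystem B W)
    (h : ∀ σ, ∀ v ∈ M.weightSpace (S.wt σ), f v = g v) : f = g :=
  LinearMap.ext_on (S.span_eq_top M) fun v ⟨σ, hv⟩ => h σ v hv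

theorem linearMap_ext₂ {M N : FinRep B} {P : Type*} [AddCommGroup P] [Module k P]
    {f g : M.V ⊗[k] N.V →ₗ[k] P} (S : WeightSystem B W)
    (h : ∀ σ τ, ∀ x ∈ M.weightSpace (S.wt σ), ∀ y ∈ N.weightSpace (S.wt τ),
      f (x ⊗ₜ y) = g (x ⊗ₜ y)) : f = g :=
  TensorProduct.ext (S.linearMap_ext fun σ x hx => S.linearMap_ext fun τ y hy => h σ τ x hx y hy)

theorem associator_hom_apply {M N P : FinRep B} {ρ σ τ : W} {x : M.V} {y : N.V} {z : P.V}
    (hx : x ∈ M.weightSpace (S.wt ρ)) (hy : y ∈ N.weightSpace (S.wt σ))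
    (hz : z ∈ P.weightSpace (S.wt τ)) :
    (α_ M N P).hom.lin ((x ⊗ₜ[k] y) ⊗ₜ[k] z) =
      (S.assocScalar ρ σ τ : k) • (x ⊗ₜ[k] (y ⊗ₜ[k] z)) :=
  tensorAct_apply_of_char hx (tensorAct_apply_of_char hy hz) B.φ.1

theorem associator_inv_apply {M N P : FinRep B} {ρ σ τ : W} {x : M.V} {y : N.V} {z : P.V}
    (hx : x ∈ M.weightSpace (S.wt ρ)) (hy : y ∈ N.weightSpace (S.wt σ))
    (hz : z ∈ P.weightSpace (S.wt τ)) :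
    (α_ M N P).inv.lin (x ⊗ₜ[k] (y ⊗ₜ[k] z)) =
      ((S.assocScalar ρ σ τ)⁻¹ : kˣ).val • ((x ⊗ₜ[k] y) ⊗ₜ[k] z) := by
  have h := congrArg (fun f => f.lin ((x ⊗ₜ[k] y) ⊗ₜ[k] z)) (α_ M N P).hom_inv_id
  have h' : (α_ M N P).inv.lin ((α_ M N P).hom.lin ((x ⊗ₜ[k] y) ⊗ₜ[k] z)) =
    ((x ⊗ₜ[k] y) ⊗ₜ[k] z) := h
  rw [associator_hom_apply (S := S) hx hy hz, map_smul] at h'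
  rw [← h', smul_smul, Units.inv_mul, one_smul]

/-! ### The half-braiding of an object of the center on one-dimensional representations -/

/-- The endomorphism of `X` given by its half-braiding with a one-dimensional representation. -/
def halfAct (X : Center (FinRep B)) (χ : H →ₐ[k] k) : X.1.V →ₗ[k] X.1.V :=
  (TensorProduct.lid k X.1.V).toLinearMap ∘ₗ (X.2.β (line B χ)).hom.lin ∘ₗ
    (TensorProduct.rid k X.1.V).symm.toLinearMap

theorem halfBraiding_line_apply (X : Center (FinRep B)) (χ : H →ₐ[k] k) (x : X.1.V) :
    (X.2.β (line B χ)).hom.lin (x ⊗ₜ[k] (1 : k)) = (1 : k) ⊗ₜ[k] halfAct X χ x := by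
  apply (TensorProduct.lid k X.1.V).injective
  rw [TensorProduct.lid_tmul, one_smul]
  rfl

/-- A weight vector y is the image of 1 under a morphism from a line, and the half-braiding is
natural in its second argument. As weight vectors span, the operators `halfAct` determine the whole
half-braiding. -/
theorem halfBraiding_apply (X : Center (FinRep B)) {Y : FinRep B} {χ : H →ₐ[k] k} {y : Y.V}
    (hy : y ∈ Y.weightSpace χ) (x : X.1.V) :
    (X.2.β Y).hom.lin (x ⊗ₜ[k] y) = y ⊗ₜ[k] halfAct X χ x := by
  have h := congrArg (fun f => f.lin (x ⊗ₜ[k] (1 : k))) (X.2.naturality (ofWeight hy))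
  have h' : (X.2.β Y).hom.lin (x ⊗ₜ[k] (ofWeight hy).lin (1 : k)) =
      TensorProduct.map (ofWeight hy).lin LinearMap.id
        ((X.2.β (line B χ)).hom.lin (x ⊗ₜ[k] (1 : k))) := h
  rw [halfBraiding_line_apply, TensorProduct.map_tmul, ofWeight_apply] at h'
  exact h'

/-- The line of the counit is the unit object, on which every half-braiding is the composite of the
two unitors. -/
theorem halfAct_counit (X : Center (FinRep B)) (x : X.1.V) : halfAct X B.ε x = x := by
  have h : (X.2.β (𝟙_ (FinRep B))).hom = (ρ_ X.1).hom ≫ (λ_ X.1).inv := by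
    have := congrArg Center.Hom.f (braiding_tensorUnit_right X)
    rwa [Center.comp_f, Center.rightUnitor_hom_f, Center.leftUnitor_inv_f] at this
  have h1 : (X.2.β (𝟙_ (FinRep B))).hom.lin (x ⊗ₜ[k] (1 : k)) =
      (ρ_ X.1 ≪≫ (λ_ X.1).symm).hom.lin (x ⊗ₜ[k] (1 : k)) :=
    congrArg (fun f => f.lin (x ⊗ₜ[k] (1 : k))) h
  have h2 := congrArg (TensorProduct.lid k X.1.V) ((halfBraiding_line_apply X B.ε x).symm.trans h1)
  rw [TensorProduct.lid_tmul, one_smul] at h2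
  rw [h2]
  change TensorProduct.lid k X.1.V ((TensorProduct.lid k X.1.V).symm
    (TensorProduct.rid k X.1.V (x ⊗ₜ[k] (1 : k)))) = x
  simp

/-- The half-braiding intertwines, so 1 ⊗ c_σ x has the weight ρσ = σρ of x ⊗ 1. On it h acts
through (σ ⊗ id)Δ(h) on X, so the weight of c_σ x is known on all elements of that form.
`translate_surjective` says that these exhaust H. -/
theorem halfAct_mem (X : Center (FinRep B)) {ρ σ : W} {x : X.1.V}
    (hx : x ∈ X.1.weightSpace (S.wt ρ)) : halfAct X (S.wt σ) x ∈ X.1.weightSpace (S.wt ρ) := by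
  have key : ∀ h, X.1.ρ (Algebra.TensorProduct.lid k H
      (Algebra.TensorProduct.map (S.wt σ) (AlgHom.id k H) (B.Δ h))) (halfAct X (S.wt σ) x) =
        S.wt (ρ * σ) h • halfAct X (S.wt σ) x := by
    intro h
    have h1 := LinearMap.congr_fun ((X.2.β (line B (S.wt σ))).hom.comm h) (x ⊗ₜ[k] (1 : k))
    have h2 : (X.1 ⊗ line B (S.wt σ) : FinRep B).ρ h (x ⊗ₜ[k] (1 : k)) =
      S.wt (ρ * σ) h • (x ⊗ₜ[k] (1 : k)) := tmul_mem (S := S) hx (line_mem (S.wt σ) 1) h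
    rw [LinearMap.comp_apply, LinearMap.comp_apply, h2, map_smul, halfBraiding_line_apply] at h1
    have h3 := congrArg (TensorProduct.lid k X.1.V) h1
    rw [map_smul, TensorProduct.lid_tmul, one_smul] at h3
    rw [h3]
    have h4 : (TensorProduct.lid k X.1.V).toLinearMap ∘ₗ
        tensorAct ((Algebra.lmul k k).comp (S.wt σ)) X.1.ρ (B.Δ h) =
        X.1.ρ (Algebra.TensorProduct.lid k H
          (Algebra.TensorProduct.map (S.wt σ) (AlgHom.id k H) (B.Δ h))) ∘ₗ
          (TensorProduct.lid k X.1.V).toLinearMap := by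
      rw [tensorAct_comp_left, tensorAct_lid]
    have h5 := LinearMap.congr_fun h4 ((1 : k) ⊗ₜ[k] halfAct X (S.wt σ) x)
    simp only [LinearMap.comp_apply, LinearEquiv.coe_coe, TensorProduct.lid_tmul, one_smul] at h5
    exact h5.symm
  have key' : ∀ h, S.wt (ρ * σ) h = S.wt ρ (Algebra.TensorProduct.lid k H
      (Algebra.TensorProduct.map (S.wt σ) (AlgHom.id k H) (B.Δ h))) := by
    intro h
    rw [S.mul_comm, ← S.wt_mul]
    generalize B.Δ h = t
    induction t with
    | zero => simp
    | add x y hx hy => simp only [map_add, hx, hy]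
    | tmul a b => simp
  intro h
  obtain ⟨h, rfl⟩ := S.translate_surjective σ h
  exact (key h).trans (by rw [key' h])

/-- This is the hexagon evaluated on x ⊗ (1 ⊗ 1). By `halfAct_mem` the weight ρ persists along the
way, so each of the three associators acts by a scalar. -/
theorem halfAct_mul (X : Center (FinRep B)) {ρ σ τ : W} {x : X.1.V}
    (hx : x ∈ X.1.weightSpace (S.wt ρ)) : halfAct X (S.wt (σ * τ)) x =
      (S.hexScalar ρ σ τ : k) • halfAct X (S.wt τ) (halfAct X (S.wt σ) x) := by
  have hσ := line_mem (B := B) (S.wt σ) 1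
  have hτ := line_mem (B := B) (S.wt τ) 1
  have h1 := halfBraiding_apply X (tmul_mem (S := S) hσ hτ) x
  have h2 : (X.2.β (line B (S.wt σ) ⊗ line B (S.wt τ))).hom.lin
        (x ⊗ₜ[k] ((1 : k) ⊗ₜ[k] (1 : k))) =
      (α_ (line B (S.wt σ)) (line B (S.wt τ)) X.1).inv.lin
        (TensorProduct.map LinearMap.id (X.2.β (line B (S.wt τ))).hom.lin
          ((α_ (line B (S.wt σ)) X.1 (line B (S.wt τ))).hom.lin
            (TensorProduct.map (X.2.β (line B (S.wt σ))).hom.lin LinearMap.id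
              ((α_ X.1 (line B (S.wt σ)) (line B (S.wt τ))).inv.lin
                (x ⊗ₜ[k] ((1 : k) ⊗ₜ[k] (1 : k))))))) :=
    congrArg (fun f => f.lin (x ⊗ₜ[k] ((1 : k) ⊗ₜ[k] (1 : k))))
      (X.2.monoidal (line B (S.wt σ)) (line B (S.wt τ)))
  have hm := halfAct_mem (σ := σ) X hx
  rw [associator_inv_apply (S := S) hx hσ hτ, map_smul, map_smul, map_smul, map_smul,
    TensorProduct.map_tmul, halfBraiding_line_apply, LinearMap.id_apply,
    associator_hom_apply (S := S) hσ hm hτ, map_smul, map_smul, TensorProduct.map_tmul,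
    halfBraiding_line_apply, LinearMap.id_apply,
    associator_inv_apply (S := S) hσ hτ (halfAct_mem (σ := τ) X hm)] at h2
  have h3 := h1.symm.trans h2
  -- Contracting the two factors k turns the identity in (k ⊗ k) ⊗ X into one in X.
  have h4 := congrArg (fun t => TensorProduct.lid k X.1.V
    (TensorProduct.map (TensorProduct.lid k k).toLinearMap LinearMap.id t)) h3
  simp only [map_smul, TensorProduct.map_tmul, LinearEquiv.coe_coe, TensorProduct.lid_tmul,
    one_smul, LinearMap.id_apply] at h4
  rw [h4, smul_smul, smul_smul, hexScalar]
  congr 1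
  rw [← Units.val_mul, ← Units.val_mul, div_eq_mul_inv, mul_inv, mul_assoc,
    mul_left_comm]

/-- Powers of σ are written as iterates of left multiplication on 1, because W carries no
associativity. -/
theorem halfAct_iterate (X : Center (FinRep B)) {ρ σ : W} (N : ℕ) {x : X.1.V}
    (hx : x ∈ X.1.weightSpace (S.wt ρ)) : halfAct X (S.wt ((σ * ·)^[N] (1 : W))) x =
      ((∏ m ∈ Finset.range N, S.hexScalar ρ σ ((σ * ·)^[m] (1 : W)) : kˣ) : k) •
        (halfAct X (S.wt σ))^[N] x := by
  induction N generalizing x with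
  | zero =>
    rw [Function.iterate_zero_apply, Function.iterate_zero_apply, S.wt_one, halfAct_counit,
      Finset.prod_range_zero, Units.val_one, one_smul]
  | succ N ih =>
    rw [Function.iterate_succ_apply', halfAct_mul X hx, ih (halfAct_mem X hx), smul_smul,
      Finset.prod_range_succ, Units.val_mul, _root_.mul_comm, Function.iterate_succ_apply]

/-! ### An upper bound for the exponent -/

theorem halfAct_iterate_eq_self {N : ℕ} (hN : ∀ σ : W, (σ * ·)^[N] 1 = 1)
    (hS : ∀ ρ σ : W, ∏ m ∈ Finset.range N, S.hexScalar ρ σ ((σ * ·)^[m] 1) = 1)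
    (X : Center (FinRep B)) {ρ σ : W} {x : X.1.V} (hx : x ∈ X.1.weightSpace (S.wt ρ)) :
    (halfAct X (S.wt σ))^[N] x = x := by
  have h := halfAct_iterate (σ := σ) X N hx
  rw [hN, hS, S.wt_one, halfAct_counit, Units.val_one, one_smul] at h
  exact h.symm

/-- The double braiding splits as c_σ ⊗ c_ρ on the tensor product of the two weight spaces. Both
factors preserve weights, so the formula passes to powers. -/
theorem doubleBraiding_lin_pow_apply (X Y : Center (FinRep B)) {ρ σ : W} {x : X.1.V} {y : Y.1.V}
    (hx : x ∈ X.1.weightSpace (S.wt ρ)) (hy : y ∈ Y.1.weightSpace (S.wt σ)) (N : ℕ) :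
    ((((Y.2.β X.1).hom.lin ∘ₗ (X.2.β Y.1).hom.lin : X.1.V ⊗[k] Y.1.V →ₗ[k] X.1.V ⊗[k] Y.1.V) :
      Module.End k (X.1.V ⊗[k] Y.1.V)) ^ N) (x ⊗ₜ y) =
      ((halfAct X (S.wt σ))^[N] x) ⊗ₜ[k] ((halfAct Y (S.wt ρ))^[N] y) := by
  induction N generalizing x y with
  | zero => simp
  | succ N ih =>
    have h : (Y.2.β X.1).hom.lin ((X.2.β Y.1).hom.lin (x ⊗ₜ[k] y)) =
        halfAct X (S.wt σ) x ⊗ₜ[k] halfAct Y (S.wt ρ) y := by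
      rw [halfBraiding_apply X hy, halfBraiding_apply Y (halfAct_mem (σ := σ) X hx)]
    rw [pow_succ, Module.End.mul_apply, LinearMap.comp_apply, h,
      ih (halfAct_mem X hx) (halfAct_mem Y hy), Function.iterate_succ_apply,
      Function.iterate_succ_apply]

theorem mapEnd_doubleBraiding_pow_lin (X Y : Center (FinRep B)) (N : ℕ) :
    Hom.lin ((Center.forget (FinRep B)).mapEnd (X ⊗ Y) (doubleBraiding X Y ^ N) - 1) =
      (((Y.2.β X.1).hom.lin ∘ₗ (X.2.β Y.1).hom.lin : X.1.V ⊗[k] Y.1.V →ₗ[k] X.1.V ⊗[k] Y.1.V) :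
      Module.End k (X.1.V ⊗[k] Y.1.V)) ^ N - 1 := by
  rw [map_pow]
  exact (sub_one_lin (M := X.1 ⊗ Y.1) _).trans (congrArg (· - 1) (lin_pow (M := X.1 ⊗ Y.1) _ N))

theorem doubleBraiding_unipotent {N : ℕ} (hN : ∀ σ : W, (σ * ·)^[N] 1 = 1)
    (hS : ∀ ρ σ : W, ∏ m ∈ Finset.range N, S.hexScalar ρ σ ((σ * ·)^[m] 1) = 1)
    (X Y : Center (FinRep B)) :
    IsNilpotent ((Center.forget (FinRep B)).mapEnd (X ⊗ Y) (doubleBraiding X Y ^ N) - 1) := by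
  -- The N-th power is the identity itself, so the first power of the difference already vanishes.
  refine ⟨1, ?_⟩
  rw [pow_one]
  apply FinRep.hom_ext
  have h : (((Y.2.β X.1).hom.lin ∘ₗ (X.2.β Y.1).hom.lin :
      X.1.V ⊗[k] Y.1.V →ₗ[k] X.1.V ⊗[k] Y.1.V) : Module.End k (X.1.V ⊗[k] Y.1.V)) ^ N = 1 := by
    refine S.linearMap_ext₂ fun ρ σ x hx y hy => ?_
    rw [doubleBraiding_lin_pow_apply X Y hx hy, halfAct_iterate_eq_self hN hS X hx,
      halfAct_iterate_eq_self hN hS Y hy, Module.End.one_apply]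
  refine (mapEnd_doubleBraiding_pow_lin X Y N).trans ?_
  rw [h]
  exact sub_self _

/-! ### One-dimensional objects of the center -/

/-- A weight together with an element of `H` that defines a half-braiding on the corresponding
one-dimensional representation. -/
structure CentralLine (S : WeightSystem B W) where
  weight : W
  elt : H
  ne_zero : ∀ σ, S.wt σ elt ≠ 0
  mul : ∀ σ τ, S.wt (σ * τ) elt = S.hexScalar weight σ τ * (S.wt σ elt * S.wt τ elt)

/-- The range of r contains every weight vector, hence is everything; finite dimension then gives
injectivity. This makes the half-braiding built from r invertible. -/
theorem bijective_of_ne_zero (S : WeightSystem B W) (r : H) (hr : ∀ σ, S.wt σ r ≠ 0)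
    (M : FinRep B) : Function.Bijective (M.ρ r) := by
  have h : Function.Surjective (M.ρ r) := by
    rw [← LinearMap.range_eq_top, eq_top_iff, ← S.span_eq_top M, Submodule.span_le]
    rintro v ⟨σ, hv⟩
    exact ⟨(S.wt σ r)⁻¹ • v, by rw [map_smul, hv, smul_smul, inv_mul_cancel₀ (hr σ), one_smul]⟩
  exact ⟨LinearMap.injective_iff_surjective.2 h, h⟩

namespace CentralLine

/-- The half-braiding, as a linear equivalence. -/
def equiv (L : CentralLine S) (M : FinRep B) : k ⊗[k] M.V ≃ₗ[k] M.V ⊗[k] k :=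
  (TensorProduct.comm k k M.V).trans (TensorProduct.congr
    (LinearEquiv.ofBijective (M.ρ L.elt) (S.bijective_of_ne_zero _ L.ne_zero M))
    (LinearEquiv.refl k k))

theorem equiv_tmul (L : CentralLine S) (M : FinRep B) (c : k) (v : M.V) :
    L.equiv M (c ⊗ₜ v) = M.ρ L.elt v ⊗ₜ c := rfl

theorem equiv_tmul_of_mem (L : CentralLine S) {M : FinRep B} {σ : W} {v : M.V}
    (hv : v ∈ M.weightSpace (S.wt σ)) (c : k) :
    L.equiv M (c ⊗ₜ v) = S.wt σ L.elt • (v ⊗ₜ c) := by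
  rw [equiv_tmul, hv, smul_tmul']

/-- The half-braiding, as an isomorphism of representations. -/
def iso (L : CentralLine S) (M : FinRep B) :
    (line B (S.wt L.weight) ⊗ M : FinRep B) ≅ M ⊗ line B (S.wt L.weight) :=
  mkIso (M := line B (S.wt L.weight) ⊗ M) (N := M ⊗ line B (S.wt L.weight)) (L.equiv M) (by
    intro h
    -- On weight vectors both sides are scalars, and they agree because the product of weights is
    -- commutative.
    refine TensorProduct.ext (LinearMap.ext fun c => S.linearMap_ext fun σ v hv => ?_)
    have h1 : (line B (S.wt L.weight) ⊗ M : FinRep B).ρ h (c ⊗ₜ[k] v) =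
      S.wt (L.weight * σ) h • (c ⊗ₜ[k] v) := tmul_mem (S := S) (line_mem _ c) hv h
    have h2 : (M ⊗ line B (S.wt L.weight) : FinRep B).ρ h (v ⊗ₜ[k] c) =
      S.wt (σ * L.weight) h • (v ⊗ₜ[k] c) := tmul_mem (S := S) hv (line_mem _ c) h
    change L.equiv M ((line B (S.wt L.weight) ⊗ M : FinRep B).ρ h (c ⊗ₜ[k] v)) =
      (M ⊗ line B (S.wt L.weight) : FinRep B).ρ h (L.equiv M (c ⊗ₜ[k] v))
    rw [h1, map_smul, L.equiv_tmul_of_mem hv, map_smul, h2, S.mul_comm, smul_comm])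

theorem iso_apply_of_mem (L : CentralLine S) {M : FinRep B} {σ : W} {v : M.V}
    (hv : v ∈ M.weightSpace (S.wt σ)) (c : k) :
    (L.iso M).hom.lin (c ⊗ₜ[k] v) = S.wt σ L.elt • (v ⊗ₜ[k] c) :=
  L.equiv_tmul_of_mem hv c

/-- The object of the Drinfeld center. -/
def toCenter (L : CentralLine S) : Center (FinRep B) :=
  ⟨line B (S.wt L.weight),
    { β := L.iso
      monoidal := fun U U' => by
        apply FinRep.hom_ext
        -- On weight vectors the hexagon becomes an identity of scalars, namely the field `mul`.
        refine TensorProduct.ext (LinearMap.ext fun c =>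
          S.linearMap_ext₂ (M := U) (N := U') fun σ τ u hu v hv => ?_)
        have hc := line_mem (B := B) (S.wt L.weight) c
        change (L.iso (U ⊗ U')).hom.lin (c ⊗ₜ[k] (u ⊗ₜ[k] v)) =
          (α_ U U' (line B (S.wt L.weight))).inv.lin
            (TensorProduct.map LinearMap.id (L.iso U').hom.lin
              ((α_ U (line B (S.wt L.weight)) U').hom.lin
                (TensorProduct.map (L.iso U).hom.lin LinearMap.id
                  ((α_ (line B (S.wt L.weight)) U U').inv.lin (c ⊗ₜ[k] (u ⊗ₜ[k] v))))))
        rw [L.iso_apply_of_mem (tmul_mem (S := S) hu hv), associator_inv_apply (S := S) hc hu hv,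
          map_smul, map_smul, map_smul, map_smul, TensorProduct.map_tmul, L.iso_apply_of_mem hu,
          ← smul_tmul', map_smul, map_smul, map_smul, LinearMap.id_apply,
          associator_hom_apply (S := S) hu hc hv, map_smul, map_smul, TensorProduct.map_tmul,
          L.iso_apply_of_mem hv, LinearMap.id_apply, tmul_smul, map_smul,
          associator_inv_apply (S := S) hu hv hc, smul_smul, smul_smul, smul_smul, smul_smul, L.mul]
        congr 1
        rw [hexScalar, div_eq_mul_inv, mul_inv, Units.val_mul, Units.val_mul]
        ring
      naturality := fun {U U'} f => by
        apply FinRep.hom_ext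
        refine TensorProduct.ext (LinearMap.ext fun c => LinearMap.ext fun u => ?_)
        -- Naturality holds because morphisms commute with the action of the element of H that
        -- defines the half-braiding.
        change U'.ρ L.elt (f.lin u) ⊗ₜ[k] c = f.lin (U.ρ L.elt u) ⊗ₜ[k] c
        rw [← LinearMap.comp_apply, ← f.comm, LinearMap.comp_apply] }⟩

/-- Unipotence of a power of the double braiding of two one-dimensional objects. -/
theorem pow_eq_one (L L' : CentralLine S) {N : ℕ}
    (h : IsNilpotent ((Center.forget (FinRep B)).mapEnd (L.toCenter ⊗ L'.toCenter)
      (doubleBraiding L.toCenter L'.toCenter ^ N) - 1)) :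
    (S.wt L'.weight L.elt * S.wt L.weight L'.elt) ^ N = 1 := by
  set d := S.wt L'.weight L.elt * S.wt L.weight L'.elt
  have h0 : ∀ t : k ⊗[k] k, (L.iso (line B (S.wt L'.weight))).hom.lin t =
      S.wt L'.weight L.elt • TensorProduct.comm k k k t := by
    intro t
    induction t with
    | zero => simp
    | add x y hx hy => rw [map_add, hx, hy, map_add, smul_add]
    | tmul a b => exact L.iso_apply_of_mem (line_mem _ b) a
  have h0' : ∀ t : k ⊗[k] k, (L'.iso (line B (S.wt L.weight))).hom.lin t =
      S.wt L.weight L'.elt • TensorProduct.comm k k k t := by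
    intro t
    induction t with
    | zero => simp
    | add x y hx hy => rw [map_add, hx, hy, map_add, smul_add]
    | tmul a b => exact L'.iso_apply_of_mem (line_mem _ b) a
  -- Each half-braiding is a scalar times the flip of k ⊗ k, and the two flips cancel.
  have h1 : (((L'.iso (line B (S.wt L.weight))).hom.lin ∘ₗ
      (L.iso (line B (S.wt L'.weight))).hom.lin : k ⊗[k] k →ₗ[k] k ⊗[k] k) :
      Module.End k (k ⊗[k] k)) = algebraMap k (Module.End k (k ⊗[k] k)) d := by
    refine LinearMap.ext fun t => ?_
    rw [LinearMap.comp_apply, h0, map_smul, h0', smul_smul, Module.algebraMap_end_apply]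
    congr 1
    exact (TensorProduct.comm k k k).symm_apply_apply t
  obtain ⟨m, hm⟩ := h
  have h2 : algebraMap k (Module.End k (k ⊗[k] k)) ((d ^ N - 1) ^ m) = 0 := by
    rw [map_pow, map_sub, map_pow, map_one, ← h1]
    have := congrArg Hom.lin hm
    rw [lin_pow, mapEnd_doubleBraiding_pow_lin] at this
    exact this
  have h3 := congrArg (TensorProduct.lid k k) (LinearMap.congr_fun h2 ((1 : k) ⊗ₜ[k] (1 : k)))
  rw [Module.algebraMap_end_apply, map_smul, TensorProduct.lid_tmul] at h3
  simp only [smul_eq_mul, mul_one, LinearMap.zero_apply, map_zero] at h3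
  -- A unipotent scalar in a field is 1.
  exact sub_eq_zero.1 (eq_zero_of_pow_eq_zero h3)

end CentralLine

end WeightSystem

/-! ### The exponent as an infimum. -/

section Exponent

variable {C : Type*} [Category C] [Preadditive C] [MonoidalCategory C]

theorem exponent_eq_of_dvd {N : ℕ} (hN : 0 < N)
    (hu : ∀ X Y : Center C,
      IsNilpotent ((Center.forget C).mapEnd (X ⊗ Y) (doubleBraiding X Y ^ N) - 1))
    (hl : ∀ M, (∀ X Y : Center C,
      IsNilpotent ((Center.forget C).mapEnd (X ⊗ Y) (doubleBraiding X Y ^ M) - 1)) → N ∣ M) :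
    exponent C = N :=
  le_antisymm (Nat.sInf_le ⟨hN, hu⟩)
    (le_csInf ⟨N, hN, hu⟩ fun M hM => Nat.le_of_dvd hM.1 (hl M hM.2))

/-- The infimum of an empty set of naturals is 0, so some admissible N is needed for the exponent to
be finite and attained. -/
theorem exponent_spec {N : ℕ} (hN : 0 < N)
    (hu : ∀ X Y : Center C,
      IsNilpotent ((Center.forget C).mapEnd (X ⊗ Y) (doubleBraiding X Y ^ N) - 1)) :
    0 < exponent C ∧ ∀ X Y : Center C,
      IsNilpotent ((Center.forget C).mapEnd (X ⊗ Y) (doubleBraiding X Y ^ exponent C) - 1) :=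
  Nat.sInf_mem (s := {N : ℕ | 0 < N ∧ ∀ X Y : Center C,
    IsNilpotent ((Center.forget C).mapEnd (X ⊗ Y) (doubleBraiding X Y ^ N) - 1)}) ⟨N, hN, hu⟩

end Exponent

/-! ### Carries in the addition modulo `n` -/

section Carry

variable {n : ℕ}

/-- The quotient of `i + j` in the division by `n`, for the elements `a^i` and `a^j` of `C_n`. -/
def carry (x y : Multiplicative (ZMod n)) : ℕ := (x.toAdd.val + y.toAdd.val) / n

theorem carry_comm (x y : Multiplicative (ZMod n)) : carry x y = carry y x := by
  rw [carry, add_comm]; rfl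

/-- The carry measures how far i ↦ ν^i, on representatives 0 ≤ i < n, is from being a homomorphism
on C_n. All hexagon identities for ω_ζ below rest on this. -/
theorem pow_val_mul {M : Type*} [Monoid M] [NeZero n] (ν : M) (x y : Multiplicative (ZMod n)) :
    ν ^ x.toAdd.val * ν ^ y.toAdd.val = ν ^ (x * y).toAdd.val * (ν ^ n) ^ carry x y := by
  rw [← pow_add, ← pow_mul, ← pow_add, toAdd_mul, ZMod.val_add, carry, Nat.mod_add_div]

theorem val_pow (x : Multiplicative (ZMod n)) (m : ℕ) :
    (x ^ m).toAdd.val = (m * x.toAdd.val) % n := by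
  rw [toAdd_pow, nsmul_eq_mul, ZMod.val_mul, ZMod.val_natCast, Nat.mod_mul_mod]

/-- Adding i to itself modulo n, each carry raises the quotient of the running total by one, so the
sum telescopes. -/
theorem sum_carry [NeZero n] (x : Multiplicative (ZMod n)) (N : ℕ) :
    ∑ m ∈ Finset.range N, carry x (x ^ m) = N * x.toAdd.val / n := by
  have hn : 0 < n := Nat.pos_of_ne_zero (NeZero.ne n)
  induction N with
  | zero => simp
  | succ N ih =>
    rw [Finset.sum_range_succ, ih, carry, val_pow, ← Nat.mul_add_div hn]
    congr 1
    have := Nat.div_add_mod (N * x.toAdd.val) n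
    rw [add_mul, one_mul]
    omega

theorem pow_eq_one_of_dvd (x : Multiplicative (ZMod n)) {m : ℕ} (h : n ∣ m) : x ^ m = 1 := by
  apply Multiplicative.toAdd.injective
  rw [toAdd_pow, nsmul_eq_mul, (ZMod.natCast_eq_zero_iff m n).2 h, zero_mul, toAdd_one]

variable {k : Type u} [Field k] [NeZero n] {ζ : kˣ} {hζ : ζ ^ n = 1}

theorem cyclicCocycle_apply (x y z : Multiplicative (ZMod n)) :
    (cyclicCocycle n ζ hζ).toFun x y z = ζ ^ (z.toAdd.val * carry x y) := rfl

/-- The cocycle is symmetric in its first two arguments, so two of the three factors cancel. The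
same symmetry collapses θ and γ to one common expression. -/
theorem cyclicCocycle_hex (x y z : Multiplicative (ZMod n)) :
    (cyclicCocycle n ζ hζ).toFun y x z /
      ((cyclicCocycle n ζ hζ).toFun x y z * (cyclicCocycle n ζ hζ).toFun y z x) =
      (ζ ^ (x.toAdd.val * carry y z))⁻¹ := by
  rw [cyclicCocycle_apply, cyclicCocycle_apply, cyclicCocycle_apply, carry_comm y x,
    div_mul_eq_div_div, div_self', one_div]

theorem cyclicCocycle_θ (g x y : Multiplicative (ZMod n)) :
    (cyclicCocycle n ζ hζ).θ g x y = ζ ^ (g.toAdd.val * carry x y) := by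
  rw [Cocycle3.θ, inv_mul_cancel_comm, inv_mul_cancel_comm, cyclicCocycle_apply,
    cyclicCocycle_apply, cyclicCocycle_apply, carry_comm x g, mul_div_cancel_left]

theorem cyclicCocycle_γ (g x y : Multiplicative (ZMod n)) :
    (cyclicCocycle n ζ hζ).γ g x y = ζ ^ (g.toAdd.val * carry x y) := by
  rw [Cocycle3.γ, inv_mul_cancel_comm, inv_mul_cancel_comm, cyclicCocycle_apply,
    cyclicCocycle_apply, cyclicCocycle_apply, carry_comm x g, mul_div_cancel_right]

end Carry

theorem exists_units_pow_eq {k : Type u} [Field k] [IsAlgClosed k] (ζ : kˣ) {n : ℕ} (hn : n ≠ 0) :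
    ∃ ν : kˣ, ν ^ n = ζ := by
  obtain ⟨ν, hν⟩ := IsAlgClosed.exists_pow_nat_eq (ζ : k) (Nat.pos_of_ne_zero hn)
  have h0 : ν ≠ 0 := by
    rintro rfl
    exact ζ.ne_zero (by rw [← hν, zero_pow hn])
  exact ⟨Units.mk0 ν h0, Units.ext hν⟩

/-- Characters supported on single idempotents pick out one coefficient of a diagonal associator;
this computes the associator scalars in both examples. -/
theorem charTensor_diag₃ {k : Type u} [Field k] {H : Type w} [Ring H] [Algebra k H] {G : Type v}
    [Fintype G] [DecidableEq G] {e : G → H} {χ χ' χ'' : H →ₐ[k] k} {a b c : G}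
    (h : ∀ g, χ (e g) = if g = a then 1 else 0) (h' : ∀ g, χ' (e g) = if g = b then 1 else 0)
    (h'' : ∀ g, χ'' (e g) = if g = c then 1 else 0) (F : G → G → G → k) :
    charTensor χ (charTensor χ' χ'') (diag₃ e F) = F a b c := by
  simp [diag₃, Fintype.sum_prod_type, h, h', h'']

/-! ### The quasi-Hopf algebra `(k^G, ω)` -/

namespace FunAlg

open FinRep

section

variable {k : Type u} [Field k] {G : Type v} [CommGroup G] [Fintype G] [DecidableEq G]

/-- Evaluation at a group element. -/
def eval (k : Type u) [Field k] (g : G) : FunAlg G k →ₐ[k] k := Pi.evalAlgHom k (fun _ : G => k) g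

@[simp] theorem eval_apply (g : G) (f : FunAlg G k) : eval k g f = f g := rfl

theorem idem_apply (g h : G) : (idem k g : FunAlg G k) h = if h = g then 1 else 0 := by
  change (Pi.single g 1 : G → k) h = _
  exact Pi.single_apply g 1 h

theorem eval_idem (g h : G) : eval k g (idem k h) = if h = g then 1 else 0 := by
  rw [eval_apply, idem_apply]
  exact if_congr eq_comm rfl rfl

theorem mul_idem (f : FunAlg G k) (g : G) : f * idem k g = f g • idem k g := by
  conv_lhs => rw [eq_sum f]
  simp [Finset.sum_mul, idem_orthogonal]

theorem translate_comul (s : G) (f : FunAlg G k) : Algebra.TensorProduct.lid k (FunAlg G k)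
    (Algebra.TensorProduct.map (eval k s) (AlgHom.id k (FunAlg G k)) (comul G k f)) =
      ∑ t, f (s * t) • idem k t := by
  simp [comul_apply, -eval_apply, eval_idem, ite_smul, smul_ite]

/-- The evaluations at group elements form a weight system. -/
def weightSystem (ω : Cocycle3 G k) : WeightSystem (quasiBialgebra ω) G where
  wt := eval k
  wt_one := rfl
  wt_mul σ τ f := by
    change charTensor (eval k σ) (eval k τ) (comul G k f) = f (σ * τ)
    simp [comul_apply, -eval_apply, eval_idem]
  mul_comm := mul_comm
  translate_surjective σ f := by
    -- The map (ev_σ ⊗ id)Δ is translation by σ, undone by translation by σ⁻¹.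
    refine ⟨fun g => f (σ⁻¹ * g), ?_⟩
    refine (translate_comul σ _).trans ?_
    simp only [inv_mul_cancel_left]
    exact (eq_sum f).symm
  span_eq_top M := by
    refine eq_top_iff.2 fun v _ => ?_
    have hv : v = ∑ g : G, M.ρ (idem k g) v := by
      rw [← LinearMap.sum_apply, ← map_sum, idem_complete, map_one, Module.End.one_apply]
    rw [hv]
    refine Submodule.sum_mem _ fun g _ => Submodule.subset_span ⟨g, fun f => ?_⟩
    rw [← Module.End.mul_apply, ← map_mul, mul_idem, map_smul]
    rfl

theorem assocScalar_eq (ω : Cocycle3 G k) (r s t : G) :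
    (weightSystem ω).assocScalar r s t = ω.toFun r s t :=
  Units.ext (by
    change charTensor (eval k r) (charTensor (eval k s) (eval k t))
      (diag₃ (idem k) fun a b c => (ω.toFun a b c : k)) = _
    exact charTensor_diag₃ (eval_idem r) (eval_idem s) (eval_idem t) _)

end

section Cyclic

variable {k : Type u} [Field k] {n : ℕ} [NeZero n] {ζ : kˣ} {hζ : ζ ^ n = 1}

theorem hexScalar_eq (r s t : Multiplicative (ZMod n)) :
    (weightSystem (cyclicCocycle n ζ hζ)).hexScalar r s t =
      (ζ ^ (r.toAdd.val * carry s t))⁻¹ := by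
  rw [WeightSystem.hexScalar, assocScalar_eq, assocScalar_eq, assocScalar_eq, cyclicCocycle_hex]

/-- The value n² is a crude bound, used only to know that the exponent is finite: the hex scalars
multiply to the inverse of ζ^(r·n·s) = 1. -/
theorem cyclic_unipotent (X Y : Center (FinRep (quasiBialgebra (cyclicCocycle n ζ hζ)))) :
    IsNilpotent ((Center.forget _).mapEnd (X ⊗ Y) (doubleBraiding X Y ^ (n * n)) - 1) := by
  refine WeightSystem.doubleBraiding_unipotent (S := weightSystem (cyclicCocycle n ζ hζ))
    (fun σ => ?_) (fun ρ σ => ?_) X Y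
  · rw [mul_left_iterate_apply_one, pow_eq_one_of_dvd σ (dvd_mul_right n n)]
  · simp only [mul_left_iterate_apply_one, hexScalar_eq]
    rw [Finset.prod_inv_distrib, Finset.prod_pow_eq_pow_sum, ← Finset.mul_sum, sum_carry,
      mul_assoc, Nat.mul_div_cancel_left _ (Nat.pos_of_ne_zero (NeZero.ne n)), mul_left_comm,
      pow_mul, hζ, one_pow, inv_one]

/-- The central structure on the one-dimensional representation of degree `g` given by an `n`-th
root of `ζ`. -/
def centralLine (ν : kˣ) (hν : ν ^ n = ζ) (g : Multiplicative (ZMod n)) :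
    (weightSystem (cyclicCocycle n ζ hζ)).CentralLine where
  weight := g
  elt := fun h => ((ν ^ g.toAdd.val) ^ h.toAdd.val : kˣ)
  ne_zero σ := ((ν ^ g.toAdd.val) ^ σ.toAdd.val : kˣ).ne_zero
  mul σ τ := by
    change (((ν ^ g.toAdd.val) ^ (σ * τ).toAdd.val : kˣ) : k) =
      _ * (((ν ^ g.toAdd.val) ^ σ.toAdd.val : kˣ) * ((ν ^ g.toAdd.val) ^ τ.toAdd.val : kˣ))
    have hg : (ν ^ g.toAdd.val) ^ n = ζ ^ g.toAdd.val := by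
      rw [← pow_mul, mul_comm, pow_mul, hν]
    rw [← Units.val_mul, ← Units.val_mul, hexScalar_eq, pow_val_mul, hg, ← pow_mul ζ,
      -- The carry term ζ^(g·carry) of the representatives cancels the hex scalar, its inverse.
      inv_mul_eq_div, mul_div_cancel_right]

theorem exponent_pos : 0 < (quasiBialgebra (cyclicCocycle n ζ hζ)).exponent :=
  (exponent_spec (Nat.mul_pos (Nat.pos_of_ne_zero (NeZero.ne n))
    (Nat.pos_of_ne_zero (NeZero.ne n))) cyclic_unipotent).1

/-- The central line of degree a attached to an n-th root ν of ζ has double braiding ν² with itself.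
An exponent dividing n would give ν^(2n) = ζ² = 1, impossible for ζ ≠ 1 of odd order. -/
theorem not_exponent_dvd [IsAlgClosed k] (hn : Odd n) (h1 : ζ ≠ 1) :
    ¬ (quasiBialgebra (cyclicCocycle n ζ hζ)).exponent ∣ n := by
  rintro ⟨m, hm⟩
  -- Needed for the representative of 1 in `ZMod n` to be 1 and not 0.
  have hn1 : Fact (1 < n) := ⟨by
    refine lt_of_le_of_ne (Nat.pos_of_ne_zero (NeZero.ne n)) fun h => h1 ?_
    rwa [← h, pow_one] at hζ⟩
  obtain ⟨ν, hν⟩ := exists_units_pow_eq ζ (NeZero.ne n)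
  let L := centralLine (hζ := hζ) ν hν (Multiplicative.ofAdd 1)
  have h := L.pow_eq_one L ((exponent_spec (Nat.mul_pos (Nat.pos_of_ne_zero (NeZero.ne n))
    (Nat.pos_of_ne_zero (NeZero.ne n))) cyclic_unipotent).2 L.toCenter L.toCenter)
  have hL : (weightSystem (cyclicCocycle n ζ hζ)).wt L.weight L.elt = ν := by
    change (((ν ^ (1 : ZMod n).val) ^ (1 : ZMod n).val : kˣ) : k) = ν
    rw [ZMod.val_one, pow_one, pow_one]
  rw [hL, ← Units.val_mul, ← Units.val_pow_eq_pow_val, ← Units.val_one, Units.val_inj] at h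
  have h2 : ζ ^ 2 = 1 := by
    have : (ν * ν) ^ n = 1 := by
      conv_lhs => rw [hm, pow_mul]
      exact (congrArg (· ^ m) h).trans (one_pow m)
    rw [← hν, pow_two, ← mul_pow, this]
  exact h1 (orderOf_eq_one_iff.1 (Nat.eq_one_of_dvd_coprimes
    (Nat.coprime_two_left.2 hn) (orderOf_dvd_of_pow_eq_one h2) (orderOf_dvd_of_pow_eq_one hζ)))

end Cyclic

end FunAlg

/-! ### The twisted double of a cyclic group -/

/-- The characters of `D^ω C_n`: a degree `g = a^i` together with an `n`-th root of `ζ^i`, the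
value at `e_g # a`. -/
@[ext]
structure CyclicWeight {k : Type u} [Field k] (n : ℕ) [NeZero n] (ζ : kˣ) (hζ : ζ ^ n = 1) where
  deg : Multiplicative (ZMod n)
  val : kˣ
  val_pow : val ^ n = ζ ^ deg.toAdd.val

namespace CyclicWeight

variable {k : Type u} [Field k] {n : ℕ} [NeZero n] {ζ : kˣ} {hζ : ζ ^ n = 1}

instance : One (CyclicWeight n ζ hζ) := ⟨⟨1, 1, by simp⟩⟩

/-- The carry factor is the contribution of γ in the comultiplication, as `charTensor_comul`
confirms. -/
instance : Mul (CyclicWeight n ζ hζ) :=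
  ⟨fun σ τ => ⟨σ.deg * τ.deg, σ.val * τ.val * ζ ^ carry σ.deg τ.deg, by
    rw [mul_pow, mul_pow, σ.val_pow, τ.val_pow, pow_val_mul, hζ, one_pow, mul_one, ← pow_mul,
      mul_comm (carry _ _), pow_mul, hζ, one_pow, mul_one]⟩⟩

@[simp] theorem one_deg : (1 : CyclicWeight n ζ hζ).deg = 1 := rfl
@[simp] theorem one_val : (1 : CyclicWeight n ζ hζ).val = 1 := rfl
@[simp] theorem mul_deg (σ τ : CyclicWeight n ζ hζ) : (σ * τ).deg = σ.deg * τ.deg := rfl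
theorem mul_val (σ τ : CyclicWeight n ζ hζ) :
    (σ * τ).val = σ.val * τ.val * ζ ^ carry σ.deg τ.deg := rfl

theorem iterate_deg (σ : CyclicWeight n ζ hζ) (m : ℕ) :
    ((σ * ·)^[m] (1 : CyclicWeight n ζ hζ)).deg = σ.deg ^ m := by
  induction m with
  | zero => simp
  | succ m ih => rw [Function.iterate_succ_apply', mul_deg, ih, pow_succ']

theorem iterate_val (σ : CyclicWeight n ζ hζ) (m : ℕ) :
    ((σ * ·)^[m] (1 : CyclicWeight n ζ hζ)).val =
      σ.val ^ m * ζ ^ (m * σ.deg.toAdd.val / n) := by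
  rw [← sum_carry]
  induction m with
  | zero => simp
  | succ m ih =>
    rw [Function.iterate_succ_apply', mul_val, ih, iterate_deg, Finset.sum_range_succ, pow_add ζ,
      pow_succ' σ.val, mul_assoc, mul_assoc, mul_assoc]

/-- For σ of degree a^i and value l, the exponent n kills the degree. The value becomes l^(|ζ|n)
ζ^(|ζ|i), and both factors are powers of ζ^|ζ| because l^n = ζ^i. -/
theorem iterate_eq_one (σ : CyclicWeight n ζ hζ) :
    (σ * ·)^[orderOf ζ * n] (1 : CyclicWeight n ζ hζ) = 1 := by
  ext1
  · rw [iterate_deg, pow_eq_one_of_dvd _ (dvd_mul_left n _), one_deg]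
  · rw [iterate_val, mul_assoc, mul_left_comm,
      Nat.mul_div_cancel_left _ (Nat.pos_of_ne_zero (NeZero.ne n)), pow_mul ζ, pow_orderOf_eq_one,
      one_pow, mul_one, mul_comm, pow_mul, σ.val_pow, ← pow_mul, mul_comm, pow_mul,
      pow_orderOf_eq_one, one_pow, one_val]

theorem val_pow_mul (σ : CyclicWeight n ζ hζ) (x y : Multiplicative (ZMod n)) :
    σ.val ^ x.toAdd.val * σ.val ^ y.toAdd.val =
      ζ ^ (σ.deg.toAdd.val * carry x y) * σ.val ^ (x * y).toAdd.val := by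
  rw [pow_val_mul, σ.val_pow, ← pow_mul, mul_comm]

end CyclicWeight

/-! ### Characters of the twisted double, diagonalization of its modules, and the upper bound. -/

namespace TwistedDouble

open FinRep

section Cyclic

variable {k : Type u} [Field k] {n : ℕ} [NeZero n] {ζ : kˣ} {hζ : ζ ^ n = 1}

theorem bas_mul_bas_cyclic (g x h y : Multiplicative (ZMod n)) :
    bas (cyclicCocycle n ζ hζ) g x * bas (cyclicCocycle n ζ hζ) h y =
      if g = h then ((ζ ^ (g.toAdd.val * carry x y) : kˣ) : k) •
        bas (cyclicCocycle n ζ hζ) g (x * y) else 0 := by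
  rw [bas_mul_bas, mul_inv_cancel_comm, cyclicCocycle_θ]

/-- The character of `D^ω C_n` attached to a weight. -/
def character (σ : CyclicWeight n ζ hζ) : TwistedDouble (cyclicCocycle n ζ hζ) →ₐ[k] k :=
  AlgHom.ofLinearMap
    (lift _ fun g x => if g = σ.deg then ((σ.val ^ x.toAdd.val : kˣ) : k) else 0)
    (by simp [one_def])
    (fun a b => by
      induction a using induct with
      | h0 => simp
      | ha a a' h h' => simp only [add_mul, map_add, h, h']
      | hb r g x =>
      induction b using induct with
      | h0 => simp
      | ha a a' h h' => simp only [mul_add, map_add, h, h']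
      | hb s h y =>
      rw [smul_mul_smul_comm, map_smul, map_smul, map_smul, smul_mul_smul_comm]
      congr 1
      rw [bas_mul_bas_cyclic, lift_bas, lift_bas]
      by_cases hg : g = σ.deg
      · subst hg
        by_cases hh : σ.deg = h
        · rw [if_pos hh, if_pos rfl, if_pos hh.symm, map_smul, lift_bas, if_pos rfl, smul_eq_mul,
            ← Units.val_mul, ← Units.val_mul, σ.val_pow_mul]
        · rw [if_neg hh, if_neg (Ne.symm hh), map_zero, mul_zero]
      · rw [if_neg hg, zero_mul]
        split_ifs
        · rw [map_smul, lift_bas, if_neg hg, smul_zero]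
        · rw [map_zero])

theorem character_bas (σ : CyclicWeight n ζ hζ) (g x : Multiplicative (ZMod n)) :
    character σ (bas _ g x) = if g = σ.deg then ((σ.val ^ x.toAdd.val : kˣ) : k) else 0 :=
  lift_bas (fun g x => if g = σ.deg then ((σ.val ^ x.toAdd.val : kˣ) : k) else 0) g x

theorem character_idem (σ : CyclicWeight n ζ hζ) (g : Multiplicative (ZMod n)) :
    character σ (bas _ g 1) = if g = σ.deg then 1 else 0 := by
  rw [character_bas]; simp

theorem comul_bas_cyclic (g x : Multiplicative (ZMod n)) :
    comul (cyclicCocycle n ζ hζ) (bas _ g x) =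
      ∑ s, ((ζ ^ (x.toAdd.val * carry s (s⁻¹ * g)) : kˣ) : k) •
        (bas _ s x ⊗ₜ[k] bas _ (s⁻¹ * g) x) := by
  rw [comul_bas]
  simp only [cyclicCocycle_γ]

/-- Only the term s = deg σ of Δ(e_g # x) survives. Its coefficient γ is the x-th power of the carry
factor in the value of σ * τ. -/
theorem charTensor_comul (σ τ : CyclicWeight n ζ hζ) (h : TwistedDouble (cyclicCocycle n ζ hζ)) :
    charTensor (character σ) (character τ) (comul _ h) = character (σ * τ) h := by
  induction h using induct with
  | h0 => simp
  | ha a a' h h' => simp only [map_add, h, h']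
  | hb r g x =>
  rw [map_smul, map_smul, map_smul]
  congr 1
  rw [comul_bas_cyclic, map_sum, Finset.sum_eq_single σ.deg]
  · rw [map_smul, charTensor_tmul, character_bas, character_bas, character_bas, if_pos rfl]
    by_cases hg : g = σ.deg * τ.deg
    · have hg' : σ.deg⁻¹ * g = τ.deg := by rw [hg, inv_mul_cancel_left]
      rw [if_pos hg', if_pos (by exact hg), hg', smul_eq_mul, ← Units.val_mul, ← Units.val_mul,
        CyclicWeight.mul_val, mul_pow, mul_pow, ← pow_mul, mul_comm (carry _ _), mul_comm]
    · rw [if_neg fun h => hg (by rw [← h, mul_inv_cancel_left]), if_neg (by exact hg), mul_zero,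
        smul_zero]
  · intro s _ hs
    rw [map_smul, charTensor_tmul, character_bas, if_neg hs, zero_mul, smul_zero]
  · simp

theorem translate_bas (σ : CyclicWeight n ζ hζ) (g x : Multiplicative (ZMod n)) :
    Algebra.TensorProduct.lid k (TwistedDouble (cyclicCocycle n ζ hζ))
      (Algebra.TensorProduct.map (character σ) (AlgHom.id k _) (comul _ (bas _ g x))) =
      ((ζ ^ (x.toAdd.val * carry σ.deg (σ.deg⁻¹ * g)) * σ.val ^ x.toAdd.val : kˣ) : k) •
        bas _ (σ.deg⁻¹ * g) x := by
  rw [comul_bas_cyclic, map_sum, map_sum, Finset.sum_eq_single σ.deg]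
  · rw [map_smul, map_smul, Algebra.TensorProduct.map_tmul, Algebra.TensorProduct.lid_tmul,
      character_bas, if_pos rfl, smul_smul, Units.val_mul]
    rfl
  · intro s _ hs
    rw [map_smul, map_smul, Algebra.TensorProduct.map_tmul, character_bas, if_neg hs,
      TensorProduct.zero_tmul, map_zero, smul_zero]
  · simp

/-- Translation sends each basis vector to an invertible multiple of another, shifting the degree
bijectively. -/
theorem translate_surjective (σ : CyclicWeight n ζ hζ) :
    Function.Surjective fun h : TwistedDouble (cyclicCocycle n ζ hζ) =>
      Algebra.TensorProduct.lid k _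
        (Algebra.TensorProduct.map (character σ) (AlgHom.id k _) (comul _ h)) := by
  intro h
  induction h using induct with
  | h0 => exact ⟨0, by simp⟩
  | ha a a' h h' =>
    obtain ⟨b, rfl⟩ := h
    obtain ⟨b', rfl⟩ := h'
    exact ⟨b + b', by simp only [map_add]⟩
  | hb r g x =>
    refine ⟨(r * (((ζ ^ (x.toAdd.val * carry σ.deg g) * σ.val ^ x.toAdd.val)⁻¹ : kˣ) : k)) •
      bas _ (σ.deg * g) x, ?_⟩
    simp only [map_smul]
    rw [translate_bas, inv_mul_cancel_left, smul_smul, mul_assoc, Units.inv_mul, mul_one]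

/-- The central element `∑ e_g # a`. -/
def gen (n : ℕ) [NeZero n] (ζ : kˣ) (hζ : ζ ^ n = 1) : TwistedDouble (cyclicCocycle n ζ hζ) :=
  ∑ g, bas _ g (Multiplicative.ofAdd 1)

theorem gen_mul_bas (g x : Multiplicative (ZMod n)) : gen n ζ hζ * bas _ g x =
    ((ζ ^ (g.toAdd.val * carry (Multiplicative.ofAdd 1) x) : kˣ) : k) •
      bas _ g (Multiplicative.ofAdd 1 * x) := by
  simp [gen, Finset.sum_mul, bas_mul_bas_cyclic]

theorem bas_mul_gen (g : Multiplicative (ZMod n)) :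
    bas _ g 1 * gen n ζ hζ = gen n ζ hζ * bas _ g 1 := by
  simp [gen, Finset.sum_mul, Finset.mul_sum, bas_mul_bas_cyclic, carry_comm 1]

/-- Each multiplication by the generator contributes a θ, hence a carry, and `sum_carry` adds them
up. Thus the generator and the idempotents e_g produce the whole basis, and the n-th power of the
generator is ζ^i in degree a^i. -/
theorem gen_pow_mul_bas (g : Multiplicative (ZMod n)) (j : ℕ) : gen n ζ hζ ^ j * bas _ g 1 =
    ((ζ ^ (g.toAdd.val * (j * (1 : ZMod n).val / n)) : kˣ) : k) •
      bas _ g (Multiplicative.ofAdd 1 ^ j) := by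
  have h := fun j => sum_carry (Multiplicative.ofAdd (1 : ZMod n)) j
  simp only [toAdd_ofAdd] at h
  rw [← h]
  induction j with
  | zero => simp
  | succ j ih =>
    rw [pow_succ', mul_assoc, ih, mul_smul_comm, gen_mul_bas, smul_smul, Finset.sum_range_succ,
      mul_add, pow_add, Units.val_mul, pow_succ']

/-- For n = 1 the representative of 1 is 0, but then x.val is 0 as well. -/
theorem val_mul_val_one (x : ZMod n) : x.val * (1 : ZMod n).val = x.val := by
  rw [ZMod.val_one_eq_one_mod]
  rcases (Nat.one_le_iff_ne_zero.2 (NeZero.ne n)).eq_or_lt with h | h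
  · subst h
    have := ZMod.val_lt x
    omega
  · rw [Nat.mod_eq_of_lt h, mul_one]

theorem gen_pow_val_mul_bas (g x : Multiplicative (ZMod n)) :
    gen n ζ hζ ^ x.toAdd.val * bas _ g 1 = bas _ g x := by
  rw [gen_pow_mul_bas, val_mul_val_one, Nat.div_eq_of_lt (ZMod.val_lt _), mul_zero, pow_zero,
    Units.val_one, one_smul, ← ofAdd_nsmul, nsmul_eq_mul, mul_one, ZMod.natCast_zmod_val,
    ofAdd_toAdd]

theorem gen_pow_card_mul_bas (g : Multiplicative (ZMod n)) :
    gen n ζ hζ ^ n * bas _ g 1 = ((ζ ^ g.toAdd.val : kˣ) : k) • bas _ g 1 := by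
  rw [gen_pow_mul_bas, Nat.mul_div_cancel_left _ (Nat.pos_of_ne_zero (NeZero.ne n)),
    val_mul_val_one, pow_eq_one_of_dvd _ dvd_rfl]

theorem gen_pow_sq : gen n ζ hζ ^ (n * n) = 1 := by
  have h : ∀ g, gen n ζ hζ ^ (n * n) * bas _ g 1 = bas _ g 1 := by
    intro g
    rw [gen_pow_mul_bas, mul_assoc n n, Nat.mul_div_cancel_left _ (Nat.pos_of_ne_zero (NeZero.ne n)),
      mul_left_comm, pow_mul, hζ, one_pow, Units.val_one, one_smul,
      pow_eq_one_of_dvd _ (dvd_mul_left n n)]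
  calc gen n ζ hζ ^ (n * n) = gen n ζ hζ ^ (n * n) * ∑ g, bas _ g 1 := (mul_one _).symm
    _ = 1 := by
      rw [Finset.mul_sum, Finset.sum_congr rfl fun g _ => h g]
      rfl

/-- An eigenvector of `∑ e_g # a` that is homogeneous of degree `g` is a weight vector. -/
theorem exists_mem_weightSpace {M : FinRep (quasiBialgebra (cyclicCocycle n ζ hζ))} {v : M.V}
    {μ : k} {g : Multiplicative (ZMod n)} (hg : M.ρ (bas _ g 1) v = v)
    (hμ : M.ρ (gen n ζ hζ) v = μ • v) (hv : v ≠ 0) :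
    ∃ σ : CyclicWeight n ζ hζ, v ∈ M.weightSpace (character σ) := by
  have hpow : ∀ j : ℕ, M.ρ (gen n ζ hζ ^ j) v = μ ^ j • v := by
    intro j
    induction j with
    | zero => simp
    | succ j ih =>
      rw [pow_succ', map_mul, Module.End.mul_apply, ih, map_smul, hμ, smul_smul, pow_succ]
  -- The n-th power of the generator acts on degree g by a power of ζ, so the eigenvalue is an
  -- admissible value for a weight of degree g.
  have hn : μ ^ n = ((ζ ^ g.toAdd.val : kˣ) : k) := by
    have h : M.ρ (gen n ζ hζ ^ n * bas _ g 1) v = ((ζ ^ g.toAdd.val : kˣ) : k) • v := by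
      rw [gen_pow_card_mul_bas, map_smul, LinearMap.smul_apply, hg]
    rw [map_mul, Module.End.mul_apply, hg, hpow] at h
    exact smul_left_injective k hv h
  have h0 : μ ≠ 0 := by
    rintro rfl
    rw [zero_pow (NeZero.ne n)] at hn
    exact (ζ ^ g.toAdd.val).ne_zero hn.symm
  refine ⟨⟨g, Units.mk0 μ h0, Units.ext hn⟩, fun h => ?_⟩
  induction h using induct with
  | h0 => simp
  | ha a a' h h' => rw [map_add, map_add, LinearMap.add_apply, h, h', add_smul]
  | hb r h x =>
  rw [map_smul, map_smul, LinearMap.smul_apply, smul_assoc]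
  congr 1
  -- Inserting e_g either kills the basis element or, when h = g, turns it into a power of the
  -- generator times e_g.
  have h1 : M.ρ (bas _ h x) v = M.ρ (bas _ h x * bas _ g 1) v := by
    rw [map_mul, Module.End.mul_apply, hg]
  rw [h1, bas_mul_bas_cyclic, character_bas]
  by_cases hgh : h = g
  · subst hgh
    rw [if_pos rfl, if_pos rfl, mul_one, map_smul, ← gen_pow_val_mul_bas, map_mul,
      LinearMap.smul_apply, Module.End.mul_apply, hg, hpow, carry]
    simp [Nat.div_eq_of_lt (ZMod.val_lt _)]
  · rw [if_neg hgh, if_neg hgh, map_zero, LinearMap.zero_apply, zero_smul]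

variable [IsAlgClosed k] [CharZero k]

/-- The generator is annihilated by X^(n²) − 1, which is separable in characteristic zero, so it is
diagonalizable over k. It commutes with the idempotents e_g, so the components e_g v of an
eigenvector v are zero or homogeneous eigenvectors, hence weight vectors. -/
theorem span_weightSpace (M : FinRep (quasiBialgebra (cyclicCocycle n ζ hζ))) :
    Submodule.span k {v | ∃ σ : CyclicWeight n ζ hζ, v ∈ M.weightSpace (character σ)} = ⊤ := by
  have hss : (M.ρ (gen n ζ hζ)).IsSemisimple := by
    refine Module.End.isSemisimple_of_squarefree_aeval_eq_zero
      (p := Polynomial.X ^ (n * n) - Polynomial.C 1) (Polynomial.separable_X_pow_sub_C 1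
        (Nat.cast_ne_zero.2 (mul_ne_zero (NeZero.ne n) (NeZero.ne n))) one_ne_zero).squarefree ?_
    rw [map_sub, Polynomial.aeval_X_pow, Polynomial.aeval_C, ← map_pow, gen_pow_sq, map_one,
      map_one, sub_self]
  have htop : ⨆ μ : k, (M.ρ (gen n ζ hζ)).eigenspace μ = ⊤ := by
    rw [← Module.End.iSup_maxGenEigenspace_eq_top (M.ρ (gen n ζ hζ))]
    exact iSup_congr fun μ => (hss.isFinitelySemisimple.maxGenEigenspace_eq_eigenspace μ).symm
  rw [eq_top_iff, ← htop, iSup_le_iff]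
  intro μ v hv
  rw [Module.End.mem_eigenspace_iff] at hv
  have hsum : v = ∑ g, M.ρ (bas _ g 1) v := by
    rw [← LinearMap.sum_apply, ← map_sum, ← one_def, map_one, Module.End.one_apply]
  rw [hsum]
  refine Submodule.sum_mem _ fun g _ => ?_
  by_cases h0 : M.ρ (bas _ g 1) v = 0
  · rw [h0]
    exact Submodule.zero_mem _
  · refine Submodule.subset_span (exists_mem_weightSpace (μ := μ) (g := g) ?_ ?_ h0)
    · rw [← Module.End.mul_apply, ← map_mul, idem_orthogonal, if_pos rfl]
    · rw [← Module.End.mul_apply, ← map_mul, ← bas_mul_gen, map_mul, Module.End.mul_apply, hv,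
        map_smul]

/-- The characters of `D^ω C_n` form a weight system. -/
def weightSystem (n : ℕ) [NeZero n] (ζ : kˣ) (hζ : ζ ^ n = 1) :
    WeightSystem (quasiBialgebra (cyclicCocycle n ζ hζ)) (CyclicWeight n ζ hζ) where
  wt := character
  wt_one := AlgHom.toLinearMap_injective <| lin_ext fun g x => by
    change character 1 (bas _ g x) = counit _ (bas _ g x)
    rw [character_bas, counit_bas]
    simp
  wt_mul := charTensor_comul
  mul_comm σ τ := by
    ext1
    · exact mul_comm _ _
    · rw [CyclicWeight.mul_val, CyclicWeight.mul_val, carry_comm, mul_comm σ.val]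
  translate_surjective := translate_surjective
  span_eq_top := span_weightSpace

theorem assocScalar_eq (r s t : CyclicWeight n ζ hζ) :
    (weightSystem n ζ hζ).assocScalar r s t =
      ((cyclicCocycle n ζ hζ).toFun r.deg s.deg t.deg)⁻¹ :=
  Units.ext (by
    change charTensor (character r) (charTensor (character s) (character t))
      (diag₃ (fun g => bas _ g 1)
        fun a b c => (((cyclicCocycle n ζ hζ).toFun a b c)⁻¹ : kˣ).val) = _
    exact charTensor_diag₃ (character_idem r) (character_idem s) (character_idem t) _)

/-- The associator of the double is ω⁻¹, whence the sign opposite to the one for (k^G, ω). -/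
theorem hexScalar_eq (r s t : CyclicWeight n ζ hζ) :
    (weightSystem n ζ hζ).hexScalar r s t = ζ ^ (r.deg.toAdd.val * carry s.deg t.deg) := by
  rw [WeightSystem.hexScalar, assocScalar_eq, assocScalar_eq, assocScalar_eq, ← mul_inv,
    ← inv_div', inv_div, ← inv_inj, ← cyclicCocycle_hex (hζ := hζ), inv_div]

/-- For degrees a^r and a^s, the carries over |ζ|n steps sum to |ζ|s, so the hex scalars multiply to
ζ^(r|ζ|s) = 1. -/
theorem cyclic_unipotent (X Y : Center (FinRep (quasiBialgebra (cyclicCocycle n ζ hζ)))) :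
    IsNilpotent ((Center.forget _).mapEnd (X ⊗ Y)
      (doubleBraiding X Y ^ (orderOf ζ * n)) - 1) := by
  refine WeightSystem.doubleBraiding_unipotent (S := weightSystem n ζ hζ)
    (fun σ => σ.iterate_eq_one) (fun ρ σ => ?_) X Y
  simp only [hexScalar_eq, CyclicWeight.iterate_deg]
  rw [Finset.prod_pow_eq_pow_sum, ← Finset.mul_sum, sum_carry, mul_assoc (orderOf ζ),
    mul_left_comm (orderOf ζ), Nat.mul_div_cancel_left _ (Nat.pos_of_ne_zero (NeZero.ne n)),
    mul_left_comm, pow_mul, pow_orderOf_eq_one, one_pow]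

/-! ### Central lines over the double and the lower bound. -/

theorem character_sum (σ : CyclicWeight n ζ hζ) (c : Multiplicative (ZMod n) → k)
    (x : Multiplicative (ZMod n)) :
    character σ (∑ g, c g • bas _ g x) = c σ.deg * ((σ.val ^ x.toAdd.val : kˣ) : k) := by
  simp [character_bas]

/-- The central structure on the unit object given by the grouplike element `∑ ν^g e_g # a`. -/
def centralUnit (ν : kˣ) (hν : ν ^ n = ζ) : (weightSystem n ζ hζ).CentralLine where
  weight := 1
  elt := ∑ g, ((ν ^ g.toAdd.val : kˣ) : k) • bas _ g (Multiplicative.ofAdd 1)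
  ne_zero σ := by
    change character σ _ ≠ 0
    rw [character_sum]
    exact mul_ne_zero (Units.ne_zero _) (Units.ne_zero _)
  mul σ τ := by
    -- This covers n = 1, where the exponent is 0 but ζ = 1.
    have h1 : ζ ^ (1 : ZMod n).val = ζ := by
      rw [ZMod.val_one_eq_one_mod, ← pow_eq_pow_mod 1 hζ, pow_one]
    change character (σ * τ) _ = _ * (character σ _ * character τ _)
    rw [character_sum, character_sum, character_sum, hexScalar_eq]
    simp only [← Units.val_mul]
    -- The carry lost by ν^i on representatives is the one gained by the value of σ * τ; in weight 1
    -- the hex scalar is trivial.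
    rw [mul_mul_mul_comm, pow_val_mul, hν, CyclicWeight.mul_val, mul_pow, mul_pow, toAdd_ofAdd,
      pow_right_comm, h1, mul_assoc (ν ^ _), mul_comm (ζ ^ carry σ.deg τ.deg)]
    simp

/-- A central structure on the one-dimensional representation attached to a weight. -/
def centralLine (ν : kˣ) (hν : ν ^ n = ζ) (ρ : CyclicWeight n ζ hζ) :
    (weightSystem n ζ hζ).CentralLine where
  weight := ρ
  elt := ∑ g, (((ν⁻¹ ^ ρ.deg.toAdd.val) ^ g.toAdd.val : kˣ) : k) • bas _ g 1
  ne_zero σ := by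
    change character σ _ ≠ 0
    rw [character_sum]
    exact mul_ne_zero (Units.ne_zero _) (Units.ne_zero _)
  mul σ τ := by
    have hg : (ν⁻¹ ^ ρ.deg.toAdd.val) ^ n = (ζ ^ ρ.deg.toAdd.val)⁻¹ := by
      rw [← pow_mul, mul_comm, pow_mul, inv_pow, hν, inv_pow]
    change character (σ * τ) _ = _ * (character σ _ * character τ _)
    rw [character_sum, character_sum, character_sum, hexScalar_eq]
    simp only [← Units.val_mul]
    -- Using ν⁻¹ instead of ν produces the inverse of the hex scalar.
    rw [mul_mul_mul_comm, pow_val_mul, hg, pow_mul, inv_pow]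
    simp

theorem wt_centralUnit (ν : kˣ) (hν : ν ^ n = ζ) (σ : CyclicWeight n ζ hζ) :
    (weightSystem n ζ hζ).wt σ (centralUnit ν hν).elt =
      ((ν ^ σ.deg.toAdd.val : kˣ) : k) * ((σ.val ^ (1 : ZMod n).val : kˣ) : k) :=
  character_sum σ (fun g => ((ν ^ g.toAdd.val : kˣ) : k)) (Multiplicative.ofAdd 1)

theorem wt_one_centralLine (ν : kˣ) (hν : ν ^ n = ζ) (ρ : CyclicWeight n ζ hζ) :
    (weightSystem n ζ hζ).wt 1 (centralLine ν hν ρ).elt = 1 :=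
  (character_sum 1 (fun g => (((ν⁻¹ ^ ρ.deg.toAdd.val) ^ g.toAdd.val : kˣ) : k)) 1).trans
    (by simp)

/-- Braiding the central unit with the central line of weight (g, l) gives this scalar, the second
half-braiding being trivial on the unit object. -/
theorem pow_eq_one_of_unipotent {N : ℕ}
    (h : ∀ X Y : Center (FinRep (quasiBialgebra (cyclicCocycle n ζ hζ))),
      IsNilpotent ((Center.forget _).mapEnd (X ⊗ Y) (doubleBraiding X Y ^ N) - 1))
    {ν : kˣ} (hν : ν ^ n = ζ) (g : Multiplicative (ZMod n)) (l : kˣ)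
    (hl : l ^ n = ζ ^ g.toAdd.val) : (ν ^ g.toAdd.val * l ^ (1 : ZMod n).val) ^ N = 1 := by
  have h1 : ((weightSystem n ζ hζ).wt ⟨g, l, hl⟩ (centralUnit ν hν).elt *
      (weightSystem n ζ hζ).wt 1 (centralLine ν hν ⟨g, l, hl⟩).elt) ^ N = 1 :=
    (centralUnit (hζ := hζ) ν hν).pow_eq_one (centralLine ν hν ⟨g, l, hl⟩)
      (h (centralUnit ν hν).toCenter (centralLine ν hν ⟨g, l, hl⟩).toCenter)
  rw [wt_centralUnit, wt_one_centralLine, mul_one, ← Units.val_mul, ← Units.val_pow_eq_pow_val,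
    Units.val_eq_one] at h1
  exact h1

theorem dvd_of_unipotent (hn : Odd n) {N : ℕ}
    (h : ∀ X Y : Center (FinRep (quasiBialgebra (cyclicCocycle n ζ hζ))),
      IsNilpotent ((Center.forget _).mapEnd (X ⊗ Y) (doubleBraiding X Y ^ N) - 1)) :
    orderOf ζ * n ∣ N := by
  rcases (Nat.one_le_iff_ne_zero.2 (NeZero.ne n)).eq_or_lt with h1 | h1
  · have hζ1 : ζ = 1 := by rwa [← h1, pow_one] at hζ
    rw [hζ1, orderOf_one, ← h1]
    exact one_dvd N
  have : Fact (1 < n) := ⟨h1⟩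
  have : NeZero (n : k) := ⟨Nat.cast_ne_zero.2 (NeZero.ne n)⟩
  obtain ⟨ν, hν⟩ := exists_units_pow_eq ζ (NeZero.ne n)
  obtain ⟨η, hη⟩ := HasEnoughRootsOfUnity.exists_primitiveRoot k n
  have hη' := hη.isUnit_unit (NeZero.ne n)
  -- In trivial degree the scalar is a primitive n-th root of unity, which forces n ∣ N.
  have h2 := pow_eq_one_of_unipotent h hν 1 (hη.isUnit (NeZero.ne n)).unit (by
    rw [toAdd_one, ZMod.val_zero, pow_zero, hη'.pow_eq_one])
  rw [toAdd_one, ZMod.val_zero, pow_zero, one_mul, ZMod.val_one, pow_one] at h2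
  obtain ⟨m, rfl⟩ := hη'.dvd_of_pow_eq_one _ h2
  -- In degree a with value ν the scalar is ν², so with N = nm one gets ζ^(2m) = 1.
  have h3 := pow_eq_one_of_unipotent h hν (Multiplicative.ofAdd 1) ν (by
    rw [toAdd_ofAdd, ZMod.val_one, pow_one, hν])
  rw [toAdd_ofAdd, ZMod.val_one, pow_one, pow_mul, mul_pow, hν, ← pow_two, ← pow_mul] at h3
  rw [mul_comm n]
  -- Oddness of n enters here: the order of ζ divides n, so it is coprime to 2.
  refine Nat.mul_dvd_mul_right (Nat.Coprime.dvd_of_dvd_mul_left ?_ (orderOf_dvd_of_pow_eq_one h3)) n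
  exact (Nat.coprime_two_right.2 hn).coprime_dvd_left (orderOf_dvd_of_pow_eq_one hζ)

theorem exponent_cyclic (hn : Odd n) :
    (quasiBialgebra (cyclicCocycle n ζ hζ)).exponent = orderOf ζ * n :=
  exponent_eq_of_dvd (Nat.mul_pos (orderOf_pos_iff.2
      (isOfFinOrder_iff_pow_eq_one.2 ⟨n, Nat.pos_of_ne_zero (NeZero.ne n), hζ⟩))
    (Nat.pos_of_ne_zero (NeZero.ne n))) cyclic_unipotent fun _ h => dvd_of_unipotent hn h

end Cyclic
end TwistedDouble
end

end QuasiHopf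

/-! ### Assembly of the results. -/

theorem mainTheorem9 (k : Type u) [Field k] [IsAlgClosed k] [CharZero k] :
    (∀ (n : ℕ) [NeZero n], Odd n → ∀ (ζ : kˣ) (hζ : ζ ^ n = 1),
      (QuasiHopf.TwistedDouble.quasiBialgebra (QuasiHopf.cyclicCocycle n ζ hζ)).exponent =
        orderOf ζ * n ∧
      (ζ ≠ 1 →
        0 < (QuasiHopf.FunAlg.quasiBialgebra (QuasiHopf.cyclicCocycle n ζ hζ)).exponent ∧
        ¬ (QuasiHopf.FunAlg.quasiBialgebra (QuasiHopf.cyclicCocycle n ζ hζ)).exponent ∣ n)) ∧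
    ∃ (G : Type) (_ : Group G) (_ : Fintype G) (_ : DecidableEq G)
      (ω : QuasiHopf.Cocycle3 G k),
      0 < (QuasiHopf.FunAlg.quasiBialgebra ω).exponent ∧
      ¬ (QuasiHopf.FunAlg.quasiBialgebra ω).exponent ∣ Fintype.card G := by
  refine ⟨fun n _ hn ζ hζ => ⟨QuasiHopf.TwistedDouble.exponent_cyclic hn, fun h1 =>
    ⟨QuasiHopf.FunAlg.exponent_pos, QuasiHopf.FunAlg.not_exponent_dvd hn h1⟩⟩, ?_⟩
  -- The smallest odd n with a nontrivial ζ is n = 3, with ζ a primitive cube root of unity.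
  obtain ⟨η, hη⟩ := HasEnoughRootsOfUnity.exists_primitiveRoot k 3
  have hη' := hη.isUnit_unit (NeZero.ne 3)
  refine ⟨Multiplicative (ZMod 3), inferInstance, inferInstance, inferInstance,
    QuasiHopf.cyclicCocycle 3 _ hη'.pow_eq_one, QuasiHopf.FunAlg.exponent_pos, ?_⟩
  rw [Fintype.card_multiplicative, ZMod.card]
  exact QuasiHopf.FunAlg.not_exponent_dvd (by decide) (hη'.ne_one (by norm_num))
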